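/- Let $(R,\mathfrak m)$ be a Noetherian local ring of dimension $d\ge 2$ with $\operatorname{depth} R\ge d-1$, and let $q$ be a parameter ideal of $R$, i.e. an ideal generated by $d$ elements with $\sqrt q=\mathfrak m$. For $n\in\mathbb Z$ put $H_q(n)=\lambda_R(R/q^n)$, the length of $R/q^n$, where $q^n=R$ for $n\le 0$. Let $e_0(q),\dots,e_d(q)$ be the Hilbert coefficients of $q$, i.e. the unique integers (which exist) such that the polynomial $$P_q(n)=\sum_{i=0}^{d}(-1)^i e_i(q)\binom{n+d-i-1}{d-i}$$ satisfies $H_q(n)=P_q(n)$ for all sufficiently large $n$; here $\binom{m}{k}=m(m-1)\cdots(m-k+1)/k!$ for every integer $m$. Let $n(q)=\min\{j\in\mathbb Z : H_q(n)=P_q(n)\text{ for all integers } n>j\}$ be the postulation number of $q$ (this minimum exists). Let $\operatorname{gr}_q(R)=\bigoplus_{n\ge 0}q^n/q^{n+1}$ be the associated graded ring, and let $\operatorname{depth}\operatorname{gr}_q(R)$ be the maximal length of a regular sequence in its homogeneous maximal ideal $\mathfrak m/q\oplus\bigoplus_{n\ge 1}q^n/q^{n+1}$. Then: 1. $e_2(q)\le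 0$. 2. $e_2(q)=0$ if and only if $n(q)<2-d$ and $\operatorname{depth}\operatorname{gr}_q(R)\ge d-1$. 3. If $e_2(q)=0$, then $e_3(q)=e_4(q)=\cdots=e_d(q)=0$. -/

import Mathlib

open Polynomial

noncomputable section

/-- The grade of an ideal `I` of a ring `A`: the supremum of the lengths of the `A`-regular
sequences whose members lie in `I`. -/
def Ideal.regularGrade {A : Type*} [CommRing A] (I : Ideal A) : ℕ∞ :=
  ⨆ (rs : List A) (_ : RingTheory.Sequence.IsRegular A rs ∧ ∀ r ∈ rs, r ∈ I), (rs.length : ℕ∞)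

/-- The depth of a local ring: the supremum of the lengths of the regular sequences in its
maximal ideal. -/
def IsLocalRing.ringDepth (R : Type*) [CommRing R] [IsLocalRing R] : ℕ∞ :=
  (IsLocalRing.maximalIdeal R).regularGrade

/-- A parameter ideal of a local ring: an ideal generated by a full system of parameters, that is,
by `dim R` elements which generate an ideal whose radical is the maximal ideal. -/
def Ideal.IsParameterIdeal {R : Type*} [CommRing R] [IsLocalRing R] (q : Ideal R) : Prop :=
  ∃ (d : ℕ) (x : Fin d → R), ringKrullDim R = d ∧ q = Ideal.span (Set.range x) ∧
    q.radical = IsLocalRing.maximalIdeal R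

/-- The Hilbert function `n ↦ λ(R / I ^ n)` on the integers, where `I ^ n = R` for `n ≤ 0`. The
length is finite for the ideals of interest, those whose radical is the maximal ideal of a
Noetherian local ring. -/
def Ideal.hilbertFunction {R : Type*} [CommRing R] (I : Ideal R) (n : ℤ) : ℤ :=
  ((Module.length R (R ⧸ I ^ n.toNat)).toNat : ℤ)

/-- The value at `n` of the polynomial `∑ i ≤ d, (-1) ^ i * e i * binom (n + d - i - 1) (d - i)`.
Here `Ring.choose m k` is `m (m - 1) ⋯ (m - k + 1) / k!` for every integer `m`. -/
def hilbertSum (d : ℕ) (e : ℕ → ℤ) (n : ℤ) : ℤ :=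
  ∑ i ∈ Finset.range (d + 1), (-1) ^ i * e i * Ring.choose (n + d - i - 1) (d - i)

/-- `e 0, …, e d` are the Hilbert coefficients of the ideal `I` of a `d`-dimensional ring: the
polynomial which they define agrees with the Hilbert function for all large `n`. By convention
`e i = 0` for `i > d`. -/
structure Ideal.IsHilbertCoeff {R : Type*} [CommRing R] (I : Ideal R) (d : ℕ) (e : ℕ → ℤ) :
    Prop where
  eventually_eq : ∀ᶠ n : ℤ in Filter.atTop, I.hilbertFunction n = hilbertSum d e n
  eq_zero : ∀ i, d < i → e i = 0

theorem hilbertSum_add_one_sub (d : ℕ) (e : ℕ → ℤ) (n : ℤ) :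
    hilbertSum (d + 1) e (n + 1) - hilbertSum (d + 1) e n = hilbertSum d e (n + 1) := by
  unfold hilbertSum
  rw [Finset.sum_range_succ _ (d + 1), Finset.sum_range_succ _ (d + 1)]
  simp only [Nat.sub_self, Ring.choose_zero_right, add_sub_add_right_eq_sub,
    ← Finset.sum_sub_distrib]
  refine Finset.sum_congr rfl fun i hi => ?_
  have hi' : i ≤ d := Nat.lt_succ_iff.mp (Finset.mem_range.mp hi)
  have h1 : d + 1 - i = (d - i) + 1 := by omega
  have h2 : (n + 1 + ((d + 1 : ℕ) : ℤ) - i - 1) = (n + ((d + 1 : ℕ) : ℤ) - i - 1) + 1 := by ring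
  have h3 : (n + 1 + (d : ℤ) - i - 1) = n + ((d + 1 : ℕ) : ℤ) - i - 1 := by push_cast; ring
  rw [h1, h2, h3, Ring.choose_succ_succ]
  ring

/-- Two coefficient families whose polynomials agree for all large `n` are equal, so the Hilbert
coefficients are unique. -/
theorem hilbertSum_unique (d : ℕ) (e e' : ℕ → ℤ)
    (h : ∀ᶠ n : ℤ in Filter.atTop, hilbertSum d e n = hilbertSum d e' n) :
    ∀ i ≤ d, e i = e' i := by
  induction d with
  | zero =>
    obtain ⟨n, hn⟩ := h.exists
    intro i hi
    obtain rfl : i = 0 := by omega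
    simpa [hilbertSum] using hn
  | succ d ih =>
    have hlow : ∀ i ≤ d, e i = e' i := by
      apply ih
      obtain ⟨N, hN⟩ := Filter.eventually_atTop.mp h
      refine Filter.eventually_atTop.mpr ⟨N + 1, fun n hn => ?_⟩
      have h1 := hilbertSum_add_one_sub d e (n - 1)
      have h2 := hilbertSum_add_one_sub d e' (n - 1)
      have h3 := hN n (by linarith)
      have h4 := hN (n - 1) (by linarith)
      rw [sub_add_cancel] at h1 h2
      rw [← h1, ← h2, h3, h4]
    intro i hi
    rcases Nat.lt_or_ge d i with hlt | hle
    · obtain rfl : i = d + 1 := by omega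
      obtain ⟨n, hn⟩ := h.exists
      unfold hilbertSum at hn
      rw [Finset.sum_range_succ _ (d + 1), Finset.sum_range_succ _ (d + 1),
        Finset.sum_congr rfl fun i hi => by
          rw [hlow i (Nat.lt_succ_iff.mp (Finset.mem_range.mp hi))]] at hn
      simpa using hn
    · exact hlow i hle

theorem Ideal.IsHilbertCoeff.unique {R : Type*} [CommRing R] {I : Ideal R} {d : ℕ} {e e' : ℕ → ℤ}
    (h : I.IsHilbertCoeff d e) (h' : I.IsHilbertCoeff d e') : e = e' := by
  funext i
  rcases Nat.lt_or_ge d i with hlt | hle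
  · rw [h.eq_zero i hlt, h'.eq_zero i hlt]
  · refine hilbertSum_unique d e e' ?_ i hle
    filter_upwards [h.eventually_eq, h'.eventually_eq] with n hn hn'
    rw [← hn, hn']

/-- The Hilbert coefficients `e_i(I)` of an ideal `I` of a `d`-dimensional ring. -/
def Ideal.hilbertCoeff {R : Type*} [CommRing R] (I : Ideal R) (d : ℕ) : ℕ → ℤ :=
  Classical.epsilon (I.IsHilbertCoeff d)

/-- The Hilbert-Samuel polynomial `P_I(n)` of an ideal `I` of a `d`-dimensional ring, as a function
on the integers. -/
def Ideal.hilbertSamuelPoly {R : Type*} [CommRing R] (I : Ideal R) (d : ℕ) (n : ℤ) : ℤ :=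
  hilbertSum d (I.hilbertCoeff d) n

/-- The integers `j` such that `H_I(n) = P_I(n)` for all integers `n > j`. -/
def Ideal.postulationSet {R : Type*} [CommRing R] (I : Ideal R) (d : ℕ) : Set ℤ :=
  {j | ∀ n, j < n → I.hilbertFunction n = I.hilbertSamuelPoly d n}

/-- The postulation number `n(I)`: the least integer `j` such that `H_I(n) = P_I(n)` for all
integers `n > j`. -/
def Ideal.postulationNumber {R : Type*} [CommRing R] (I : Ideal R) (d : ℕ) : ℤ :=
  sInf (I.postulationSet d)

/-- The ideal of the Rees algebra `⨁ I ^ n` that consists of the elements whose component in each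
degree `n` lies in `I ^ (n + 1)`. -/
def Ideal.reesSucc {R : Type*} [CommRing R] (I : Ideal R) : Ideal (reesAlgebra I) where
  carrier := {f | ∀ n, (f : R[X]).coeff n ∈ I ^ (n + 1)}
  zero_mem' := fun n => by simp
  add_mem' := fun {f g} hf hg n => by
    simpa using (I ^ (n + 1)).add_mem (hf n) (hg n)
  smul_mem' := fun c f hf n => by
    have h : ((c • f : reesAlgebra I) : R[X]) = (c : R[X]) * (f : R[X]) := rfl
    rw [h, coeff_mul]
    refine Ideal.sum_mem _ fun p hp => ?_
    have hp' : p.1 + p.2 = n := by simpa using hp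
    have hpow : I ^ (n + 1) = I ^ p.1 * I ^ (p.2 + 1) := by
      rw [← pow_add, ← hp', add_assoc]
    rw [hpow]
    exact Ideal.mul_mem_mul (c.2 p.1) (hf p.2)

/-- The associated graded ring `gr_I(R) = ⨁ I ^ n / I ^ (n + 1)`, as the quotient of the Rees
algebra `⨁ I ^ n` by its ideal `⨁ I ^ (n + 1)`. -/
abbrev Ideal.assocGraded {R : Type*} [CommRing R] (I : Ideal R) : Type _ :=
  reesAlgebra I ⧸ I.reesSucc

/-- For a proper ideal `I` of a local ring with maximal ideal `m`, the homogeneous maximal ideal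
`m / I ⊕ I / I ^ 2 ⊕ I ^ 2 / I ^ 3 ⊕ ⋯` of `gr_I(R)`: the classes of the elements of the Rees
algebra whose component in degree zero lies in `m`. -/
def Ideal.assocGradedMaximalIdeal {R : Type*} [CommRing R] [IsLocalRing R] (I : Ideal R) :
    Ideal I.assocGraded :=
  ((IsLocalRing.maximalIdeal R).comap
    ((constantCoeff (R := R)).comp (reesAlgebra I).val.toRingHom)).map
      (Ideal.Quotient.mk I.reesSucc)

/-- The depth of `gr_I(R)`: the supremum of the lengths of the regular sequences in its homogeneous
maximal ideal. -/
def Ideal.assocGradedDepth {R : Type*} [CommRing R] [IsLocalRing R] (I : Ideal R) : ℕ∞ :=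
  Ideal.regularGrade (A := I.assocGraded) I.assocGradedMaximalIdeal

end

/-! Write H and P for the Hilbert function and polynomial. The proof inducts on the number d of
generators of q, cutting by a superficial element. Over the flat extension R[X] localized at mR[X],
the generic combination ξ = Σ x_i X^i serves this purpose, whatever the residue field: by a filtered
McCoy theorem (`mem_map_C_of_mul_mem`), multiplication by ξ detects whatever multiplication by all
of q detects. So ξ is a nonzerodivisor and (q^(n+1) : ξ) = q^n for large n. Modulo ξ, the image q'
of q needs one generator fewer, the depth drops by one, and H_q(n+1) - H_q(n) ≤ H_q'(n+1), with
equality exactly when (q^(n+1) : ξ) = q^n, in particular for large n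
(`exists_superficial_reduction`). Hence q and q' share e_0, …, e_(d-1).

For d = 2 the ideal q' is principal, and H_q' ≤ P_q' on the naturals (`exists_hilbertSum_one`). So
P_q - H_q is nondecreasing on the naturals; it is eventually 0 and equals e_2 at 0, whence e_2 ≤ 0.
If e_2 = 0, every inequality is an equality, so the initial form of ξ is regular on the graded ring.
For d > 2, e_2 is inherited from q'. If it vanishes, gr of q' has positive depth, and Sally's
descent (`mem_pow_of_mul_mem_of_map_mk`) makes the initial form of ξ regular: depth gr rises by one,
and H = P reaches one step further into the negative integers. Depth statements return to R by
faithful flatness of the Rees algebras.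

Finally H vanishes at n ≤ 0, while P(0), P(-1), …, P(2-d) form a triangular system in e_d, …, e_2
(`hilbertSum_neg`). This turns agreement on n ≥ 2-d into the vanishing of e_2, …, e_d. -/

namespace Ideal

/-! ### Regular sequences modulo an ideal. -/

/-- `x` is a nonzerodivisor modulo the ideal `I`. -/
def IsRegularMod {A : Type*} [CommRing A] (I : Ideal A) (x : A) : Prop :=
  ∀ a, x * a ∈ I → a ∈ I

/-- The ideal `J` contains a sequence of length `r` that is weakly regular on `A ⧸ I`. -/
def HasGrade {A : Type*} [CommRing A] (J : Ideal A) : ℕ → Ideal A → Prop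
  | 0, _ => True
  | r + 1, I => ∃ x ∈ J, I.IsRegularMod x ∧ HasGrade J r (I ⊔ span {x})

section Grade

variable {A : Type*} [CommRing A] {I J : Ideal A}

theorem isRegularMod_iff {x : A} : I.IsRegularMod x ↔ IsSMulRegular (A ⧸ I) x := by
  rw [isSMulRegular_quotient_iff_mem_of_smul_mem]
  rfl

theorem HasGrade.of_succ {r : ℕ} : ∀ {I : Ideal A}, J.HasGrade (r + 1) I → J.HasGrade r I := by
  induction r with
  | zero => exact fun _ => trivial
  | succ r ih => exact fun ⟨x, hx, hreg, h⟩ => ⟨x, hx, hreg, ih h⟩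

theorem HasGrade.mono {r s : ℕ} (hrs : r ≤ s) (h : J.HasGrade s I) : J.HasGrade r I := by
  induction s, hrs using Nat.le_induction with
  | base => exact h
  | succ s _ ih => exact ih h.of_succ

theorem hasGrade_iff_exists_list {r : ℕ} : ∀ {I : Ideal A}, J.HasGrade r I ↔
    ∃ rs : List A, rs.length = r ∧ (∀ x ∈ rs, x ∈ J) ∧
      ∀ i (h : i < rs.length), (I ⊔ ofList (rs.take i)).IsRegularMod rs[i] := by
  induction r with
  | zero => exact fun {I} => ⟨fun _ => ⟨[], rfl, by simp, by simp⟩, fun _ => trivial⟩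
  | succ r ih =>
    intro I
    constructor
    · rintro ⟨x, hx, hreg, h⟩
      obtain ⟨rs, hlen, hmem, hrs⟩ := ih.mp h
      refine ⟨x :: rs, by simp [hlen], by simpa [hx] using hmem, ?_⟩
      rintro (_ | i) hi
      · simpa using hreg
      · have := hrs i (by simpa using hi)
        simpa [ofList_cons, sup_assoc] using this
    · rintro ⟨_ | ⟨x, rs⟩, hlen, hmem, hrs⟩
      · simp at hlen
      · refine ⟨x, hmem x (by simp), ?_, ih.mpr ⟨rs, by simpa using hlen,
          fun y hy => hmem y (by simp [hy]), fun i hi => ?_⟩⟩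
        · have := hrs 0 (by simp)
          rwa [List.take_zero, ofList_nil, sup_bot_eq] at this
        · have := hrs (i + 1) (by simpa using hi)
          rwa [List.take_succ_cons, ofList_cons, ← sup_assoc] at this

theorem isWeaklyRegular_iff_isRegularMod {rs : List A} :
    RingTheory.Sequence.IsWeaklyRegular A rs ↔
      ∀ i (h : i < rs.length), (ofList (rs.take i)).IsRegularMod rs[i] := by
  rw [RingTheory.Sequence.isWeaklyRegular_iff]
  refine forall₂_congr fun i h => ?_
  rw [isSMulRegular_quotient_iff_mem_of_smul_mem, smul_eq_mul, mul_top]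
  rfl

theorem hasGrade_bot_of_le_regularGrade {r : ℕ} (h : (r : ℕ∞) ≤ J.regularGrade) :
    J.HasGrade r ⊥ := by
  cases r with
  | zero => trivial
  | succ r =>
    have hlt : (r : ℕ∞) < J.regularGrade :=
      lt_of_lt_of_le (by exact_mod_cast r.lt_succ_self) h
    unfold regularGrade at hlt
    simp only [lt_iSup_iff] at hlt
    obtain ⟨rs, ⟨hreg, hmem⟩, hlt⟩ := hlt
    refine HasGrade.mono (s := rs.length) (by exact_mod_cast hlt) ?_
    exact hasGrade_iff_exists_list.mpr ⟨rs, rfl, hmem, by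
      simpa using isWeaklyRegular_iff_isRegularMod.mp hreg.toIsWeaklyRegular⟩

/-- A weakly regular sequence inside a proper ideal generates a proper ideal, so it is regular. -/
theorem HasGrade.le_regularGrade {r : ℕ} (hJ : J ≠ ⊤) (h : J.HasGrade r ⊥) :
    (r : ℕ∞) ≤ J.regularGrade := by
  obtain ⟨rs, rfl, hmem, hrs⟩ := hasGrade_iff_exists_list.mp h
  refine le_iSup₂_of_le (f := fun (rs : List A)
    (_ : RingTheory.Sequence.IsRegular A rs ∧ ∀ r ∈ rs, r ∈ J) => (rs.length : ℕ∞))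
    rs ⟨⟨isWeaklyRegular_iff_isRegularMod.mpr (by simpa using hrs), ?_⟩, hmem⟩ le_rfl
  intro htop
  refine hJ (top_le_iff.mp ?_)
  rw [smul_eq_mul, mul_top] at htop
  rw [htop]
  exact span_le.mpr hmem

/-- Prime avoidance over the associated primes of all the quotients at once: if `J` lay in one of
them, it would annihilate a nonzero class `g`. -/
theorem exists_forall_isRegularMod [IsNoetherianRing A] {ι : Type*} [Finite ι] (I : ι → Ideal A)
    (h : ∀ i, ∀ g ∉ I i, ∃ x ∈ J, x * g ∉ I i) : ∃ x ∈ J, ∀ i, (I i).IsRegularMod x := by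
  by_contra! hcon
  have hfin : (⋃ i, associatedPrimes A (A ⧸ I i)).Finite :=
    Set.finite_iUnion fun i => associatedPrimes.finite A (A ⧸ I i)
  obtain ⟨P, hP, hJP⟩ := (J.subset_union_prime_finite hfin (f := id) 0 0 fun P hP _ _ => by
      obtain ⟨i, hi⟩ := Set.mem_iUnion.mp hP
      exact hi.isPrime).1 <| by
    intro x hx
    obtain ⟨i, hi⟩ := hcon x hx
    simp only [IsRegularMod, not_forall] at hi
    obtain ⟨a, hxa, ha⟩ := hi
    have hmem : x ∈ ⋃ p ∈ associatedPrimes A (A ⧸ I i), (p : Set A) := by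
      rw [biUnion_associatedPrimes_eq_zero_divisors]
      refine ⟨Ideal.Quotient.mk _ a, by rwa [Ne, Ideal.Quotient.eq_zero_iff_mem], ?_⟩
      rw [← Ideal.Quotient.mk_eq_mk, ← Submodule.Quotient.mk_smul, Submodule.Quotient.mk_eq_zero]
      exact hxa
    obtain ⟨p, hp, hxp⟩ := Set.mem_iUnion₂.mp hmem
    exact Set.mem_iUnion₂.mpr ⟨p, Set.mem_iUnion.mpr ⟨i, hp⟩, hxp⟩
  obtain ⟨i, hi⟩ := Set.mem_iUnion.mp hP
  rw [AssociatedPrimes.mem_iff, isAssociatedPrime_iff] at hi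
  obtain ⟨hprime, y, rfl⟩ := hi
  obtain ⟨g, rfl⟩ := Ideal.Quotient.mk_surjective y
  have hg : g ∉ I i := fun hg => hprime.ne_top <| by
    simp [Ideal.Quotient.eq_zero_iff_mem.mpr hg]
  obtain ⟨x, hx, hxg⟩ := h i g hg
  have := hJP hx
  rw [id, Submodule.mem_colon_singleton, Submodule.mem_bot, ← Ideal.Quotient.mk_eq_mk,
    ← Submodule.Quotient.mk_smul, Submodule.Quotient.mk_eq_zero] at this
  exact hxg this

/-- The half of the exchange of two members of a regular sequence that holds in any commutative
ring. -/
theorem IsRegularMod.sup_swap {x z : A} (hx : I.IsRegularMod x)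
    (hzx : (I ⊔ span {x}).IsRegularMod z) :
    (I ⊔ span {z}).IsRegularMod x := by
  intro a ha
  obtain ⟨i, hi, _, hb, hib⟩ := Submodule.mem_sup.mp ha
  obtain ⟨n, rfl⟩ := mem_span_singleton'.mp hb
  obtain ⟨j, hj, _, hc, hjc⟩ := Submodule.mem_sup.mp (hzx n <| Submodule.mem_sup.mpr
    ⟨-i, I.neg_mem hi, x * a, mem_span_singleton'.mpr ⟨a, mul_comm _ _⟩, by rw [← hib]; ring⟩)
  obtain ⟨m, rfl⟩ := mem_span_singleton'.mp hc
  have : a - m * z ∈ I := hx _ <| by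
    have : x * (a - m * z) = i + z * j := by
      rw [mul_sub, ← hib, ← hjc]; ring
    rw [this]
    exact I.add_mem hi (I.mul_mem_left _ hj)
  exact Submodule.mem_sup.mpr ⟨_, this, m * z, mem_span_singleton'.mpr ⟨m, rfl⟩, by ring⟩

/-- If `J` annihilated `g` modulo `(I, y)`, write x g ≡ n y and w g ≡ m y modulo `I`. Cancelling y
gives w n ≡ x m, so n ≡ l x by regularity of w, and cancelling x gives g ≡ l y. Thus grade two
survives replacing the first member `x` by `y`. -/
theorem IsRegularMod.exists_mul_notMem {x y w : A} (hx : I.IsRegularMod x)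
    (hw : w ∈ J) (hwx : (I ⊔ span {x}).IsRegularMod w) (hxJ : x ∈ J) (hy : I.IsRegularMod y)
    {g : A} (hg : g ∉ I ⊔ span {y}) : ∃ z ∈ J, z * g ∉ I ⊔ span {y} := by
  by_contra! hcon
  obtain ⟨i, hi, _, hb, hib⟩ := Submodule.mem_sup.mp (hcon x hxJ)
  obtain ⟨n, rfl⟩ := mem_span_singleton'.mp hb
  obtain ⟨j, hj, _, hc, hjc⟩ := Submodule.mem_sup.mp (hcon w hw)
  obtain ⟨m, rfl⟩ := mem_span_singleton'.mp hc
  have h1 : w * n - x * m ∈ I := hy _ <| by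
    have : y * (w * n - x * m) = x * j - w * i := by
      linear_combination (-x) * hjc + w * hib
    rw [this]
    exact I.sub_mem (I.mul_mem_left _ hj) (I.mul_mem_left _ hi)
  have h2 : n ∈ I ⊔ span {x} := hwx n <| Submodule.mem_sup.mpr
    ⟨_, h1, x * m, mem_span_singleton'.mpr ⟨m, mul_comm _ _⟩, by ring⟩
  obtain ⟨k, hk, _, he, hke⟩ := Submodule.mem_sup.mp h2
  obtain ⟨l, rfl⟩ := mem_span_singleton'.mp he
  have h3 : g - l * y ∈ I := hx _ <| by
    have : x * (g - l * y) = i + y * k := by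
      linear_combination -hib - y * hke
    rw [this]
    exact I.add_mem hi (I.mul_mem_left _ hk)
  exact hg <| Submodule.mem_sup.mpr ⟨_, h3, l * y, mem_span_singleton'.mpr ⟨l, rfl⟩, by ring⟩

/-- Any nonzerodivisor modulo `I` in `J` can be taken as the first member of a regular sequence. -/
theorem HasGrade.sup_span_singleton [IsNoetherianRing A] {r : ℕ} : ∀ {I : Ideal A} {y : A},
    J.HasGrade (r + 1) I → y ∈ J → I.IsRegularMod y → J.HasGrade r (I ⊔ span {y}) := by
  induction r with
  | zero => exact fun _ _ _ => trivial
  | succ r ih =>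
    rintro I y ⟨x, hxJ, hx, w, hwJ, hwx, hr⟩ hyJ hy
    -- A common second member `z` for both `x` and `y` lets the two be exchanged through sequences
    -- beginning with `z`.
    obtain ⟨z, hzJ, hz⟩ := exists_forall_isRegularMod (J := J)
        ![I ⊔ span {x}, I ⊔ span {y}] <| by
      intro i
      fin_cases i
      · exact fun g hg => ⟨w, hwJ, fun h => hg (hwx g h)⟩
      · exact fun g hg => hx.exists_mul_notMem hwJ hwx hxJ hy hg
    have hzx : (I ⊔ span {x}).IsRegularMod z := hz 0
    have hzy : (I ⊔ span {y}).IsRegularMod z := hz 1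
    have h1 : J.HasGrade r (I ⊔ span {x} ⊔ span {z}) := ih ⟨w, hwJ, hwx, hr⟩ hzJ hzx
    have h2 : J.HasGrade (r + 1) (I ⊔ span {z}) :=
      ⟨x, hxJ, hx.sup_swap hzx, by rwa [sup_right_comm]⟩
    have h3 := ih h2 hyJ (hy.sup_swap hzy)
    exact ⟨z, hzJ, hzy, by rwa [sup_right_comm]⟩

end Grade

/-! ### Grade under surjections and flat extensions. -/

section Map

variable {A C : Type*} [CommRing A] [CommRing C]

theorem comap_sup_span_singleton {φ : A →+* C} (hφ : Function.Surjective φ) (I : Ideal C) (x : A) :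
    (I ⊔ span {φ x}).comap φ = I.comap φ ⊔ span {x} := by
  have : span {φ x} = (span {x}).map φ := by rw [map_span, Set.image_singleton]
  rw [this]
  have h := comap_map_of_surjective φ hφ (I.comap φ ⊔ span {x})
  rw [map_sup, map_comap_of_surjective φ hφ] at h
  rw [h, sup_eq_left]
  exact le_sup_of_le_left (comap_mono bot_le)

theorem isRegularMod_comap {φ : A →+* C} (hφ : Function.Surjective φ) {I : Ideal C} {x : A} :
    (I.comap φ).IsRegularMod x ↔ I.IsRegularMod (φ x) := by
  simp [IsRegularMod, hφ.forall]

theorem hasGrade_comap_iff {φ : A →+* C} (hφ : Function.Surjective φ) {J : Ideal C} {r : ℕ} :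
    ∀ {I : Ideal C}, (J.comap φ).HasGrade r (I.comap φ) ↔ J.HasGrade r I := by
  induction r with
  | zero => exact fun {_} => Iff.rfl
  | succ r ih =>
    intro I
    simp only [HasGrade, hφ.exists, mem_comap, isRegularMod_comap hφ, ← ih,
      comap_sup_span_singleton hφ]

theorem HasGrade.mono_left {J J' : Ideal A} (hJ : J ≤ J') {r : ℕ} :
    ∀ {I : Ideal A}, J.HasGrade r I → J'.HasGrade r I := by
  induction r with
  | zero => exact fun _ => trivial
  | succ r ih => exact fun ⟨x, hx, hreg, h⟩ => ⟨x, hJ hx, hreg, ih h⟩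

variable [Algebra A C]

theorem IsRegularMod.map_of_flat [Module.Flat A C] {I : Ideal A} {x : A} (h : I.IsRegularMod x) :
    (I.map (algebraMap A C)).IsRegularMod (algebraMap A C x) := by
  have h1 := (isRegularMod_iff.mp h).lTensor C
  have h2 : IsSMulRegular (C ⧸ I.map (algebraMap A C)) x :=
    (((Algebra.TensorProduct.quotIdealMapEquivTensorQuot C I).toLinearEquiv.restrictScalars
      A).isSMulRegular_congr x).mpr h1
  rw [isRegularMod_iff]
  intro a b hab
  exact h2 (by simpa only [algebraMap_smul] using hab)

theorem map_sup_span_singleton (I : Ideal A) (x : A) :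
    (I ⊔ span {x}).map (algebraMap A C) =
      I.map (algebraMap A C) ⊔ span {algebraMap A C x} := by
  rw [map_sup, map_span, Set.image_singleton]

theorem HasGrade.map_of_flat [Module.Flat A C] {J : Ideal A} {r : ℕ} : ∀ {I : Ideal A},
    J.HasGrade r I → (J.map (algebraMap A C)).HasGrade r (I.map (algebraMap A C)) := by
  induction r with
  | zero => exact fun _ => trivial
  | succ r ih =>
    exact fun ⟨x, hx, hreg, h⟩ => ⟨_, mem_map_of_mem _ hx, hreg.map_of_flat, by
      simpa only [map_sup_span_singleton] using ih h⟩

/-- The grade descends along faithfully flat extensions. -/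
theorem HasGrade.of_map [IsNoetherianRing A] [IsNoetherianRing C] [Module.FaithfullyFlat A C]
    {J : Ideal A} {r : ℕ} : ∀ {I : Ideal A},
    (J.map (algebraMap A C)).HasGrade r (I.map (algebraMap A C)) → J.HasGrade r I := by
  induction r with
  | zero => exact fun _ => trivial
  | succ r ih =>
    intro I h
    obtain ⟨y, hyJ, hy⟩ := exists_forall_isRegularMod (J := J) (fun _ : Unit => I) <| by
      intro _ g hg
      by_contra! hcon
      obtain ⟨x, hxJ, hx, -⟩ := h
      -- If `J` kills `g` modulo `I`, its extension does so too, and a regular element there puts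
      -- `g` in the extension of `I`, which contracts to `I`.
      have hle : J.map (algebraMap A C) ≤
          (I.map (algebraMap A C)).colon {algebraMap A C g} := by
        refine map_le_iff_le_comap.mpr fun z hz => ?_
        rw [mem_comap, Submodule.mem_colon_singleton, smul_eq_mul, ← _root_.map_mul]
        exact mem_map_of_mem _ (hcon z hz)
      have h1 := hx _ (Submodule.mem_colon_singleton.mp (hle hxJ))
      rw [← mem_comap, comap_map_eq_self_of_faithfullyFlat] at h1
      exact hg h1
    refine ⟨y, hyJ, hy (), ih ?_⟩
    rw [map_sup_span_singleton]
    exact h.sup_span_singleton (mem_map_of_mem _ hyJ) (hy ()).map_of_flat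

end Map

end Ideal

/-! ### The filtered McCoy theorem. -/

namespace Ideal

/-- A filtered form of McCoy's theorem. -/
theorem mem_map_C_of_mul_mem {R : Type*} [CommRing R] {f : R[X]} {K : ℕ → Ideal R}
    (hmul : ∀ n i, ∀ u ∈ K n, f.coeff i * u ∈ K (n + 1))
    (hreg : ∀ n u, (∀ i, f.coeff i * u ∈ K (n + 1)) → u ∈ K n) :
    ∀ (n : ℕ) (g : R[X]), f * g ∈ (K (n + 1)).map C → g ∈ (K n).map C := by
  suffices h : ∀ (k n : ℕ) (g : R[X]), g.degree < k → f * g ∈ (K (n + 1)).map C →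
      g ∈ (K n).map C from
    fun n g => h (g.natDegree + 1) n g (degree_le_natDegree.trans_lt (by
      exact_mod_cast g.natDegree.lt_succ_self))
  intro k
  induction k with
  | zero =>
    intro n g hg _
    have : g = 0 := by
      rw [← degree_eq_bot]
      simpa [Nat.WithBot.lt_zero_iff] using hg
    simp [this]
  | succ k ih =>
    intro n g hg hfg
    have hgk : ∀ b, k < b → g.coeff b = 0 := fun b hb =>
      coeff_eq_zero_of_degree_lt (hg.trans_le (by exact_mod_cast hb))
    -- Descending induction on the index `i` of a coefficient of `f`, started beyond its degree.
    have key : ∀ j i, f.natDegree < i + j → C (f.coeff i) * g ∈ (K (n + 1)).map C := by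
      intro j
      induction j with
      | zero =>
        intro i hi
        rw [coeff_eq_zero_of_natDegree_lt (by simpa using hi)]
        simp
      | succ j ihj =>
        intro i hi
        -- In the coefficient of `f * g` at i + k, the other terms involve either a vanishing
        -- coefficient of `g` or some f.coeff a with a > i, already handled.
        have htop : f.coeff i * g.coeff k ∈ K (n + 1) := by
          have h1 := (mem_map_C_iff.mp hfg) (i + k)
          rw [coeff_mul, ← Finset.add_sum_erase _ _
            (show (i, k) ∈ Finset.HasAntidiagonal.antidiagonal (i + k) by simp)] at h1
          refine (Submodule.add_mem_iff_left _ (Ideal.sum_mem _ ?_)).mp h1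
          rintro ⟨a, b⟩ hab
          simp only [Finset.mem_erase, Finset.HasAntidiagonal.mem_antidiagonal, ne_eq,
            Prod.mk.injEq] at hab
          rcases lt_or_ge k b with hb | hb
          · simp [hgk b hb]
          · have := mem_map_C_iff.mp (ihj a (by omega)) b
            simpa using this
        -- Removing the top term lowers the degree bound. The extra factor f.coeff i raises the
        -- filtration level, so the outer hypothesis is used at `n + 1`.
        have hg1 : C (f.coeff i) * (g - monomial k (g.coeff k)) ∈ (K (n + 1)).map C := by
          refine ih (n + 1) _ ?_ ?_
          · rw [degree_lt_iff_coeff_zero]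
            intro m hm
            rcases hm.eq_or_lt with rfl | hm
            · simp
            · simp [coeff_monomial, hm.ne, hgk m hm]
          · have heq : f * (C (f.coeff i) * (g - monomial k (g.coeff k))) =
                C (f.coeff i) * (f * g) - f * monomial k (f.coeff i * g.coeff k) := by
              rw [← C_mul_monomial]; ring
            rw [heq]
            refine Ideal.sub_mem _ (mem_map_C_iff.mpr fun m => ?_) (mem_map_C_iff.mpr fun m => ?_)
            · rw [coeff_C_mul]
              exact hmul _ _ _ (mem_map_C_iff.mp hfg m)
            · rw [coeff_mul]
              refine Ideal.sum_mem _ fun p _ => ?_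
              rw [coeff_monomial]
              split_ifs
              · exact hmul _ _ _ htop
              · simp
        have : C (f.coeff i) * g = C (f.coeff i) * (g - monomial k (g.coeff k)) +
            monomial k (f.coeff i * g.coeff k) := by
          rw [← C_mul_monomial]; ring
        rw [this]
        refine Ideal.add_mem _ hg1 (mem_map_C_iff.mpr fun m => ?_)
        rw [coeff_monomial]
        split_ifs
        · exact htop
        · simp
    refine mem_map_C_iff.mpr fun m => hreg n _ fun i => ?_
    simpa using mem_map_C_iff.mp (key (f.natDegree + 1) i (by omega)) m

end Ideal

/-! ### The Gauss extension and the generic element. -/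

namespace IsLocalRing

variable (R : Type*) [CommRing R] [IsLocalRing R]

/-- The localization of `R[X]` at the extension of the maximal ideal of `R`. -/
abbrev GaussExtension : Type _ := Localization.AtPrime ((maximalIdeal R).map (C : R →+* R[X]))

instance : IsLocalHom (algebraMap R (GaussExtension R)) := by
  refine ⟨fun r hr => ?_⟩
  by_contra hmem
  rw [IsScalarTower.algebraMap_apply R R[X] (GaussExtension R),
    IsLocalization.AtPrime.isUnit_to_map_iff _ ((maximalIdeal R).map (C : R →+* R[X]))] at hr
  exact hr (Ideal.mem_map_of_mem C ((mem_maximalIdeal r).mpr hmem))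

instance : Module.Flat R (GaussExtension R) := Module.Flat.trans R R[X] _

theorem map_algebraMap_gaussExtension (I : Ideal R) :
    I.map (algebraMap R (GaussExtension R)) =
      (I.map C).map (algebraMap R[X] (GaussExtension R)) := by
  rw [IsScalarTower.algebraMap_eq R R[X] (GaussExtension R), ← Ideal.map_map]
  rfl

theorem maximalIdeal_gaussExtension :
    (maximalIdeal R).map (algebraMap R (GaussExtension R)) =
      maximalIdeal (GaussExtension R) := by
  rw [map_algebraMap_gaussExtension, Localization.AtPrime.map_eq_maximalIdeal]

variable {R}

/-- The image in the Gauss extension of the polynomial with the given coefficients. -/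
noncomputable def gaussElement {d : ℕ} (x : Fin d → R) : GaussExtension R :=
  algebraMap R[X] _ (∑ i : Fin d, monomial (i : ℕ) (x i))

theorem gaussElement_eq_sum {d : ℕ} (x : Fin d → R) :
    gaussElement x = ∑ i : Fin d, algebraMap R[X] (GaussExtension R) X ^ (i : ℕ) *
      algebraMap R (GaussExtension R) (x i) := by
  simp only [gaussElement, map_sum, ← C_mul_X_pow_eq_monomial, map_mul, map_pow]
  refine Finset.sum_congr rfl fun i _ => ?_
  rw [mul_comm, IsScalarTower.algebraMap_apply R R[X] (GaussExtension R)]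
  rfl

/-- `x 0` enters the generic combination with coefficient 1, so that combination can replace it as a
generator. -/
theorem map_span_range_eq_gaussElement {d : ℕ} (x : Fin (d + 1) → R) :
    (Ideal.span (Set.range x)).map (algebraMap R (GaussExtension R)) =
      Ideal.span {gaussElement x} ⊔
        Ideal.span (Set.range fun i : Fin d => algebraMap R (GaussExtension R) (x i.succ)) := by
  rw [Ideal.map_span, ← Set.range_comp]
  have hmem : ∀ (i : Fin d), algebraMap R (GaussExtension R) (x i.succ) ∈
      Ideal.span (Set.range fun i : Fin d => algebraMap R (GaussExtension R) (x i.succ)) :=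
    fun i => Ideal.subset_span ⟨i, rfl⟩
  apply le_antisymm
  · rw [Ideal.span_le]
    rintro _ ⟨i, rfl⟩
    refine Fin.cases ?_ (fun i => ?_) i
    · have h := gaussElement_eq_sum x
      rw [Fin.sum_univ_succ] at h
      simp only [Fin.val_zero, pow_zero, one_mul] at h
      rw [SetLike.mem_coe, Function.comp_apply, eq_sub_of_add_eq h.symm]
      refine Ideal.sub_mem _ (Ideal.mem_sup_left (Ideal.mem_span_singleton_self _))
        (Ideal.mem_sup_right (Ideal.sum_mem _ fun i _ => Ideal.mul_mem_left _ _ (hmem i)))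
    · exact Ideal.mem_sup_right (hmem i)
  · rw [sup_le_iff, Ideal.span_singleton_le_iff_mem, Ideal.span_le]
    constructor
    · rw [gaussElement_eq_sum]
      exact Ideal.sum_mem _ fun i _ => Ideal.mul_mem_left _ _ (Ideal.subset_span ⟨i, rfl⟩)
    · rintro _ ⟨i, rfl⟩
      exact Ideal.subset_span ⟨i.succ, rfl⟩

/-- Clearing denominators reduces this to the filtered McCoy theorem. It serves twice: with `K` zero
for regularity of the generic element, and with shifted powers of q for superficiality. -/
theorem mem_map_of_gaussElement_mul_mem {d : ℕ} {x : Fin d → R} {K : ℕ → Ideal R}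
    (hmul : ∀ n i, ∀ u ∈ K n, x i * u ∈ K (n + 1))
    (hreg : ∀ n u, (∀ i, x i * u ∈ K (n + 1)) → u ∈ K n) (n : ℕ) (u : GaussExtension R)
    (hu : gaussElement x * u ∈ (K (n + 1)).map (algebraMap R (GaussExtension R))) :
    u ∈ (K n).map (algebraMap R (GaussExtension R)) := by
  set p := (maximalIdeal R).map (C : R →+* R[X])
  obtain ⟨g, s, rfl⟩ := IsLocalization.exists_mk'_eq p.primeCompl u
  rw [map_algebraMap_gaussExtension] at hu ⊢
  rw [gaussElement, IsLocalization.mul_mk'_eq_mk'_of_mul, IsLocalization.mk'_mem_map_algebraMap_iff]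
    at hu
  obtain ⟨w, hw, hwg⟩ := hu
  rw [IsLocalization.mk'_mem_map_algebraMap_iff]
  refine ⟨w, hw, Ideal.mem_map_C_of_mul_mem (K := K)
    (f := ∑ i : Fin d, monomial (i : ℕ) (x i)) ?_ ?_ n _ (by convert hwg using 1; ring)⟩
  · intro n i u hu
    rcases lt_or_ge i d with hi | hi
    · have : (∑ j : Fin d, monomial (j : ℕ) (x j)).coeff i = x ⟨i, hi⟩ := by
        rw [finsetSum_coeff, Finset.sum_eq_single ⟨i, hi⟩]
        · simp
        · intro j _ hj
          rw [coeff_monomial, if_neg fun h => hj (Fin.ext h)]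
        · simp
      rw [this]
      exact hmul n _ u hu
    · have : (∑ j : Fin d, monomial (j : ℕ) (x j)).coeff i = 0 := by
        rw [finsetSum_coeff, Finset.sum_eq_zero]
        intro j _
        rw [coeff_monomial, if_neg (by omega)]
      simp [this]
  · intro n u hu
    refine hreg n u fun i => ?_
    have : (∑ j : Fin d, monomial (j : ℕ) (x j)).coeff i = x i := by
      rw [finsetSum_coeff, Finset.sum_eq_single i]
      · simp
      · intro j _ hj
        rw [coeff_monomial, if_neg fun h => hj (Fin.ext h)]
      · simp
    simpa [this] using hu i

end IsLocalRing

/-! ### Colons of high powers of an ideal. -/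

namespace Ideal

variable {R : Type*} [CommRing R]

/-- One of the i + 1 factors from `q` is spent on moving `v` into `q ^ j`. -/
theorem mul_mem_pow_add_of_forall_mul_mem {q : Ideal R} {i j : ℕ} {r v : R} (hr : r ∈ q ^ (i + 1))
    (hv : ∀ y ∈ q, y * v ∈ q ^ j) : r * v ∈ q ^ (i + j) := by
  rw [pow_succ] at hr
  refine Submodule.smul_induction_on hr (fun b hb y hy => ?_) fun b c hb hc => ?_
  · rw [smul_eq_mul, mul_assoc, pow_add]
    exact mul_mem_mul hb (hv y hy)
  · rw [add_mul]
    exact add_mem hb hc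

/-- The ideal of the Rees algebra of `q` whose component in degree `n` is `a (q ^ n : q)`. -/
def reesColon (q : Ideal R) (a : R) : Ideal (reesAlgebra q) where
  carrier := {f | ∀ n, ∃ v, (∀ y ∈ q, y * v ∈ q ^ n) ∧ (f : R[X]).coeff n = a * v}
  zero_mem' := fun n => ⟨0, by simp, by simp⟩
  add_mem' := fun {f g} hf hg n => by
    obtain ⟨v, hv, hfv⟩ := hf n
    obtain ⟨w, hw, hgw⟩ := hg n
    exact ⟨v + w, fun y hy => by rw [mul_add]; exact add_mem (hv y hy) (hw y hy), by
      simp [hfv, hgw, mul_add]⟩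
  smul_mem' := fun c f hf n => by
    choose v hv hfv using hf
    have h : ((c • f : reesAlgebra q) : R[X]) = (c : R[X]) * (f : R[X]) := rfl
    refine ⟨∑ p ∈ Finset.HasAntidiagonal.antidiagonal n, (c : R[X]).coeff p.1 * v p.2,
      fun y hy => ?_, ?_⟩
    · rw [Finset.mul_sum]
      refine Ideal.sum_mem _ fun p hp => ?_
      rw [mul_left_comm, ← Finset.HasAntidiagonal.mem_antidiagonal.mp hp, pow_add]
      exact mul_mem_mul (c.2 p.1) (hv _ y hy)
    · rw [h, coeff_mul, Finset.mul_sum]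
      refine Finset.sum_congr rfl fun p _ => ?_
      rw [hfv, mul_left_comm]

/-- If `q` contains a nonzerodivisor, then `(q ^ (n + 1) : q) = q ^ n` for all large `n`. -/
theorem exists_forall_mem_pow_of_mul_mem [IsNoetherianRing R] {q : Ideal R} {a : R} (ha : a ∈ q)
    (hreg : (⊥ : Ideal R).IsRegularMod a) :
    ∃ c, ∀ n, c ≤ n → ∀ u, (∀ y ∈ q, y * u ∈ q ^ (n + 1)) → u ∈ q ^ n := by
  obtain ⟨s, hs⟩ : (reesColon q a).FG := IsNoetherian.noetherian _
  -- The Rees algebra is Noetherian, so the colon ideal has finitely many generators; `c` bounds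
  -- their degrees. Beyond it, a u T^(n+1) is a combination whose multipliers have positive degree.
  refine ⟨s.sup fun g => (g : R[X]).natDegree, fun n hn u hu => ?_⟩
  have hmem : (⟨monomial (n + 1) (a * u), reesAlgebra.monomial_mem.mpr (hu a ha)⟩ :
      reesAlgebra q) ∈ reesColon q a := by
    intro m
    rcases eq_or_ne m (n + 1) with rfl | hm
    · exact ⟨u, hu, by simp⟩
    · exact ⟨0, by simp, by simp [coeff_monomial, hm.symm]⟩
  rw [← hs] at hmem
  obtain ⟨f, -, hf⟩ := Submodule.mem_span_finset.mp hmem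
  have hgen : ∀ g ∈ s, ∃ w ∈ q ^ n, ((f g • g : reesAlgebra q) : R[X]).coeff (n + 1) = a * w := by
    intro g hg
    have hgJ : g ∈ reesColon q a := by rw [← hs]; exact Submodule.subset_span hg
    choose v hv hgv using hgJ
    have hdeg : (g : R[X]).natDegree ≤ n := (Finset.le_sup (f := fun g : reesAlgebra q =>
      (g : R[X]).natDegree) hg).trans hn
    refine ⟨∑ p ∈ Finset.HasAntidiagonal.antidiagonal (n + 1),
      if p.2 ≤ n then (f g : R[X]).coeff p.1 * v p.2 else 0, ?_, ?_⟩
    · refine Ideal.sum_mem _ fun p hp => ?_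
      split_ifs with h
      · have hp := Finset.HasAntidiagonal.mem_antidiagonal.mp hp
        -- Positive degree of the multiplier provides the factor of `q` that the colon condition on
        -- `v` consumes.
        obtain ⟨i, hi⟩ : ∃ i, p.1 = i + 1 := ⟨p.1 - 1, by omega⟩
        have := mul_mem_pow_add_of_forall_mul_mem (by rw [← hi]; exact (f g).2 p.1) (hv p.2)
        rwa [show i + p.2 = n by omega] at this
      · exact Ideal.zero_mem _
    · have h : ((f g • g : reesAlgebra q) : R[X]) = (f g : R[X]) * (g : R[X]) := rfl
      rw [h, coeff_mul, Finset.mul_sum]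
      refine Finset.sum_congr rfl fun p _ => ?_
      split_ifs with h
      · rw [hgv, mul_left_comm]
      · rw [coeff_eq_zero_of_natDegree_lt (p := (g : R[X])) (by omega), mul_zero, mul_zero]
  choose! w hw hfw using hgen
  have hau : a * u = a * ∑ g ∈ s, w g := by
    have h1 := congrArg (fun F : reesAlgebra q => (F : R[X]).coeff (n + 1)) hf
    simp only [AddSubmonoidClass.coe_finsetSum, finsetSum_coeff, coeff_monomial, if_true] at h1
    rw [← h1, Finset.mul_sum]
    exact Finset.sum_congr rfl fun g hg => hfw g hg
  have : u - ∑ g ∈ s, w g ∈ (⊥ : Ideal R) :=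
    hreg _ (by rw [mul_sub, hau, sub_self]; exact zero_mem _)
  rw [mem_bot, sub_eq_zero] at this
  rw [this]
  exact Ideal.sum_mem _ hw

end Ideal

/-! ### Lengths and Hilbert functions. -/

namespace Ideal

section Length

variable {S : Type*} [CommRing S]

theorem length_quotient_comap {R' : Type*} [CommRing R'] [Algebra S R']
    (h : Function.Surjective (algebraMap S R')) (I : Ideal R') :
    Module.length S (S ⧸ I.comap (algebraMap S R')) = Module.length R' (R' ⧸ I) := by
  rw [← Module.length_eq_of_surjective (M := R' ⧸ I) h]
  have hf : Function.Surjective (Algebra.linearMap S (R' ⧸ I)) :=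
    (Ideal.Quotient.mk_surjective (I := I)).comp h
  have hker : I.comap (algebraMap S R') = LinearMap.ker (Algebra.linearMap S (R' ⧸ I)) := by
    ext x
    rw [LinearMap.mem_ker, Algebra.linearMap_apply, IsScalarTower.algebraMap_apply S R' (R' ⧸ I),
      Ideal.Quotient.algebraMap_eq, Ideal.Quotient.eq_zero_iff_mem, mem_comap]
  exact ((Submodule.quotEquivOfEq _ _ hker).trans
    (LinearMap.quotKerEquivOfSurjective _ hf)).length_eq

/-- Multiplication by ξ gives the exact sequence 0 → S/(I : ξ) → S/I → S/(I + ξ) → 0. -/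
theorem length_quotient_eq_add (I : Ideal S) (ξ : S) :
    Module.length S (S ⧸ I) =
      Module.length S (S ⧸ I.colon {ξ}) + Module.length S (S ⧸ (I ⊔ span {ξ})) := by
  have hle : I.colon {ξ} ≤ Submodule.comap (LinearMap.mulLeft S ξ) I := fun a ha => by
    simpa [mul_comm] using Submodule.mem_colon_singleton.mp ha
  refine Module.length_eq_add_of_exact
    (Submodule.mapQ (I.colon {ξ}) I (LinearMap.mulLeft S ξ) hle)
    (Submodule.mapQ I (I ⊔ span {ξ}) LinearMap.id le_sup_left) ?_ ?_ ?_
  · rw [← LinearMap.ker_eq_bot, LinearMap.ker_eq_bot']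
    intro a
    obtain ⟨a, rfl⟩ := Submodule.mkQ_surjective _ a
    intro ha
    rw [Submodule.mkQ_apply, Submodule.mapQ_apply, Submodule.Quotient.mk_eq_zero] at ha
    rw [Submodule.mkQ_apply, Submodule.Quotient.mk_eq_zero, Submodule.mem_colon_singleton]
    simpa [mul_comm] using ha
  · intro b
    obtain ⟨b, rfl⟩ := Submodule.mkQ_surjective _ b
    exact ⟨Submodule.Quotient.mk b, rfl⟩
  · intro b
    obtain ⟨b, rfl⟩ := Submodule.mkQ_surjective _ b
    rw [Submodule.mkQ_apply, Submodule.mapQ_apply, Submodule.Quotient.mk_eq_zero,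
      LinearMap.id_apply]
    constructor
    · intro hb
      obtain ⟨i, hi, c, hc, rfl⟩ := Submodule.mem_sup.mp hb
      obtain ⟨a, rfl⟩ := mem_span_singleton'.mp hc
      refine ⟨Submodule.Quotient.mk a, ?_⟩
      rw [Submodule.mapQ_apply, Submodule.Quotient.eq]
      have : LinearMap.mulLeft S ξ a - (i + a * ξ) = -i := by
        simp only [LinearMap.mulLeft_apply]; ring
      rw [this]
      exact I.neg_mem hi
    · rintro ⟨a, ha⟩
      obtain ⟨a, rfl⟩ := Submodule.mkQ_surjective _ a
      rw [Submodule.mkQ_apply, Submodule.mapQ_apply, Submodule.Quotient.eq] at ha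
      have : b = -(LinearMap.mulLeft S ξ a - b) + a * ξ := by
        simp only [LinearMap.mulLeft_apply]; ring
      rw [this]
      exact Submodule.add_mem_sup (I.neg_mem ha) (mem_span_singleton'.mpr ⟨a, rfl⟩)

/-- Every prime of `S ⧸ I` pulls back to the maximal ideal, so this Noetherian ring is Artinian. -/
theorem length_quotient_ne_top [IsLocalRing S] [IsNoetherianRing S] {I : Ideal S} {k : ℕ}
    (h : IsLocalRing.maximalIdeal S ^ k ≤ I) : Module.length S (S ⧸ I) ≠ ⊤ := by
  have : Ring.KrullDimLE 0 (S ⧸ I) := by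
    refine Ring.KrullDimLE.mk₀ fun P hP => ?_
    have hle : IsLocalRing.maximalIdeal S ≤ P.comap (Ideal.Quotient.mk I) := by
      refine IsPrime.le_of_pow_le (n := k) (h.trans fun x hx => ?_)
      rw [mem_comap, Ideal.Quotient.eq_zero_iff_mem.mpr hx]
      exact P.zero_mem
    have hmax : (P.comap (Ideal.Quotient.mk I)).IsMaximal := by
      rw [← (IsLocalRing.maximalIdeal.isMaximal S).eq_of_le (comap_ne_top _ hP.ne_top) hle]
      exact IsLocalRing.maximalIdeal.isMaximal S
    refine (map_eq_top_or_isMaximal_of_surjective (Ideal.Quotient.mk I)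
      Ideal.Quotient.mk_surjective hmax).elim (fun h => ?_) (fun h => ?_) <;>
    rw [map_comap_of_surjective _ Ideal.Quotient.mk_surjective] at h
    · exact absurd h hP.ne_top
    · exact h
  rw [Module.length_ne_top_iff, isFiniteLength_iff_isNoetherian_isArtinian]
  have : IsArtinianRing (S ⧸ I) := isArtinianRing_iff_krullDimLE_zero.mpr this
  exact ⟨inferInstance, isArtinian_of_surjective_algebraMap (Ideal.Quotient.mk_surjective (I := I))⟩

theorem length_quotient_le_of_le {I J : Ideal S} (h : I ≤ J) :
    Module.length S (S ⧸ J) ≤ Module.length S (S ⧸ I) :=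
  Module.length_le_of_surjective (Submodule.factor h) (Submodule.factor_surjective h)

theorem eq_of_le_of_length_quotient_eq {I J : Ideal S} (h : I ≤ J)
    (hfin : Module.length S (S ⧸ I) ≠ ⊤)
    (heq : Module.length S (S ⧸ I) = Module.length S (S ⧸ J)) : I = J := by
  refine le_antisymm h fun x hx => ?_
  rw [length_quotient_eq_add I x] at heq hfin
  have h1 : Module.length S (S ⧸ J) ≤ Module.length S (S ⧸ (I ⊔ span {x})) :=
    length_quotient_le_of_le (sup_le h ((span_singleton_le_iff_mem _).mpr hx))
  have h2 : Module.length S (S ⧸ I.colon {x}) = 0 := by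
    rw [← heq] at h1
    have : Module.length S (S ⧸ (I ⊔ span {x})) ≠ ⊤ := fun h => hfin (by rw [h, add_top])
    exact le_antisymm ((ENat.add_le_add_iff_right this).mp (h1.trans_eq (zero_add _).symm)) bot_le
  rw [Module.length_eq_zero_iff, Submodule.Quotient.subsingleton_iff] at h2
  have : (1 : S) ∈ I.colon {x} := by rw [h2]; trivial
  simpa using Submodule.mem_colon_singleton.mp this

end Length

section HilbertFunction

theorem hilbertFunction_natCast {S : Type*} [CommRing S] (I : Ideal S) (n : ℕ) :
    I.hilbertFunction n = ((Module.length S (S ⧸ I ^ n)).toNat : ℤ) := rfl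

theorem hilbertFunction_of_nonpos {S : Type*} [CommRing S] (I : Ideal S) {n : ℤ} (hn : n ≤ 0) :
    I.hilbertFunction n = 0 := by
  have : Subsingleton (S ⧸ I ^ n.toNat) := by
    rw [Int.toNat_of_nonpos hn, pow_zero, one_eq_top]
    infer_instance
  simp [hilbertFunction, Module.length_eq_zero]

/-- Flat local base change multiplies length by that of the closed fibre, which is a field here. -/
theorem hilbertFunction_map_of_flat {R S : Type*} [CommRing R] [CommRing S] [IsLocalRing R]
    [IsLocalRing S] [Algebra R S] [IsLocalHom (algebraMap R S)] [Module.Flat R S]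
    (hm : (IsLocalRing.maximalIdeal R).map (algebraMap R S) = IsLocalRing.maximalIdeal S)
    (I : Ideal R) (n : ℤ) :
    (I.map (algebraMap R S)).hilbertFunction n = I.hilbertFunction n := by
  unfold hilbertFunction
  rw [← Ideal.map_pow, (Algebra.TensorProduct.quotIdealMapEquivTensorQuot S
    (I ^ n.toNat)).toLinearEquiv.length_eq, IsLocalRing.length_baseChange, hm]
  have : IsSimpleModule S (S ⧸ IsLocalRing.maximalIdeal S) :=
    isSimpleModule_iff_isCoatom.mpr (IsLocalRing.maximalIdeal.isMaximal S).out
  rw [Module.length_eq_one S (S ⧸ IsLocalRing.maximalIdeal S), mul_one]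

variable {S : Type*} [CommRing S] {q : Ideal S} {ξ : S}

theorem hilbertFunction_map_mk (q : Ideal S) (ξ : S) (n : ℕ) :
    (q.map (Ideal.Quotient.mk (span {ξ}))).hilbertFunction n =
      ((Module.length S (S ⧸ (q ^ n ⊔ span {ξ}))).toNat : ℤ) := by
  have h : (((q.map (Ideal.Quotient.mk (span {ξ}))) ^ n).comap
      (algebraMap S (S ⧸ span {ξ}))) = q ^ n ⊔ span {ξ} := by
    rw [← Ideal.map_pow, Ideal.Quotient.algebraMap_eq,
      comap_map_of_surjective _ Ideal.Quotient.mk_surjective, ← RingHom.ker_eq_comap_bot, mk_ker]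
  rw [hilbertFunction_natCast, ← length_quotient_comap Ideal.Quotient.mk_surjective, h]

/-- In the exact sequence for multiplication by ξ on S/q^(n+1), the kernel term is S/(q^(n+1) : ξ).
The colon contains q^n, so the defect is the length of (q^(n+1) : ξ)/q^n. -/
theorem hilbertFunction_add_one_sub_le (hfin : ∀ n, Module.length S (S ⧸ q ^ n) ≠ ⊤) (hξ : ξ ∈ q)
    (n : ℕ) :
    q.hilbertFunction (n + 1) - q.hilbertFunction n ≤
      (q.map (Ideal.Quotient.mk (span {ξ}))).hilbertFunction (n + 1) ∧
    (q.hilbertFunction (n + 1) - q.hilbertFunction n =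
      (q.map (Ideal.Quotient.mk (span {ξ}))).hilbertFunction (n + 1) ↔
      ∀ u, ξ * u ∈ q ^ (n + 1) → u ∈ q ^ n) := by
  have hle : q ^ n ≤ (q ^ (n + 1)).colon {ξ} := fun a ha => by
    rw [Submodule.mem_colon_singleton, pow_succ]
    exact mul_mem_mul ha hξ
  have h1 := length_quotient_eq_add (q ^ (n + 1)) ξ
  have h2 := length_quotient_le_of_le hle
  have h3 : (∀ u, ξ * u ∈ q ^ (n + 1) → u ∈ q ^ n) ↔
      Module.length S (S ⧸ q ^ n) = Module.length S (S ⧸ (q ^ (n + 1)).colon {ξ}) := by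
    constructor
    · intro h
      rw [le_antisymm hle fun u hu => h u (by
        simpa [mul_comm] using Submodule.mem_colon_singleton.mp hu)]
    · intro h u hu
      rw [eq_of_le_of_length_quotient_eq hle (hfin n) h, Submodule.mem_colon_singleton]
      simpa [mul_comm] using hu
  have hn1 := hfin (n + 1)
  have h4 := hilbertFunction_map_mk q ξ (n + 1)
  have h5 := hilbertFunction_natCast q n
  have h6 := hilbertFunction_natCast q (n + 1)
  rw [h3]
  push_cast at h4 h6
  rw [h4, h5, h6]
  have hn := hfin n
  rw [h1] at hn1 ⊢
  lift Module.length S (S ⧸ q ^ n) to ℕ using hn with a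
  lift Module.length S (S ⧸ (q ^ (n + 1)).colon {ξ}) to ℕ using
    fun h => hn1 (by rw [h, top_add]) with b
  lift Module.length S (S ⧸ (q ^ (n + 1) ⊔ span {ξ})) to ℕ using
    fun h => hn1 (by rw [h, add_top]) with e
  rw [Nat.cast_le] at h2
  simp only [← Nat.cast_add, ENat.toNat_natCast, Nat.cast_inj]
  push_cast
  omega

end HilbertFunction

end Ideal

/-! ### Rees algebras and depth of the associated graded ring. -/

namespace Ideal

section ReesMap

variable {R S : Type*} [CommRing R] [CommRing S]

/-- The homomorphism of Rees algebras induced by a ring homomorphism. -/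
noncomputable def reesMap (φ : R →+* S) (q : Ideal R) : reesAlgebra q →+* reesAlgebra (q.map φ) :=
  ((mapRingHom φ).comp (reesAlgebra q).val.toRingHom).codRestrict (reesAlgebra (q.map φ))
    fun f n => by
      change (Polynomial.map φ (f : R[X])).coeff n ∈ _
      rw [coeff_map, ← Ideal.map_pow]
      exact mem_map_of_mem φ (f.2 n)

theorem coe_reesMap (φ : R →+* S) (q : Ideal R) (f : reesAlgebra q) :
    (reesMap φ q f : S[X]) = (f : R[X]).map φ := rfl

theorem reesMap_surjective {φ : R →+* S} (hφ : Function.Surjective φ) (q : Ideal R) :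
    Function.Surjective (reesMap φ q) := by
  intro F
  have hF : ∀ n, ∃ a ∈ q ^ n, φ a = (F : S[X]).coeff n := fun n =>
    (mem_map_iff_of_surjective φ hφ).mp (by rw [Ideal.map_pow]; exact F.2 n)
  choose a ha haF using hF
  refine ⟨⟨∑ n ∈ Finset.range ((F : S[X]).natDegree + 1), monomial n (a n),
    Subalgebra.sum_mem _ fun n _ => reesAlgebra.monomial_mem.mpr (ha n)⟩, Subtype.ext ?_⟩
  rw [coe_reesMap, Polynomial.map_sum]
  simp only [map_monomial, haF]
  exact ((F : S[X]).as_sum_range).symm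

theorem mem_reesSucc {q : Ideal R} {f : reesAlgebra q} :
    f ∈ q.reesSucc ↔ ∀ n, (f : R[X]).coeff n ∈ q ^ (n + 1) := Iff.rfl

/-- The homogeneous element `a T ^ n` of the Rees algebra. -/
noncomputable def reesMonomial {q : Ideal R} {n : ℕ} {a : R} (ha : a ∈ q ^ n) : reesAlgebra q :=
  ⟨monomial n a, reesAlgebra.monomial_mem.mpr ha⟩

theorem reesMap_reesMonomial (φ : R →+* S) {q : Ideal R} {n : ℕ} {a : R} (ha : a ∈ q ^ n) :
    reesMap φ q (reesMonomial ha) =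
      reesMonomial (by rw [← Ideal.map_pow]; exact mem_map_of_mem φ ha) :=
  Subtype.ext (map_monomial φ)

theorem eq_sum_reesMonomial {q : Ideal R} (f : reesAlgebra q) :
    f = ∑ n ∈ Finset.range ((f : R[X]).natDegree + 1), reesMonomial (f.2 n) :=
  Subtype.ext <| by
    rw [AddSubmonoidClass.coe_finsetSum]
    exact (f : R[X]).as_sum_range

/-- This identifies gr of q modulo ξ with gr_q(R) modulo the initial form of ξ. An element ξ c of
q^(n+1) has c in q^n by hypothesis, so ξ c T^(n+1) is a multiple of ξ T. -/
theorem comap_reesMap_reesSucc {q : Ideal R} {ξ : R} (hξ : ξ ∈ q)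
    (h : ∀ n u, ξ * u ∈ q ^ (n + 1) → u ∈ q ^ n) :
    (q.map (Ideal.Quotient.mk (span {ξ}))).reesSucc.comap
        (reesMap (Ideal.Quotient.mk (span {ξ})) q) =
      q.reesSucc ⊔ span {reesMonomial (n := 1) (by rwa [pow_one])} := by
  apply le_antisymm
  · intro f hf
    rw [eq_sum_reesMonomial f]
    refine Ideal.sum_mem _ fun n _ => ?_
    have h1 : (f : R[X]).coeff n ∈ q ^ (n + 1) ⊔ span {ξ} := by
      have h2 := mem_reesSucc.mp (mem_comap.mp hf) n
      rw [coe_reesMap, coeff_map, ← Ideal.map_pow, ← mem_comap,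
        comap_map_of_surjective _ Ideal.Quotient.mk_surjective, ← RingHom.ker_eq_comap_bot,
        mk_ker] at h2
      exact h2
    obtain ⟨b, hb, c, hc, hbc⟩ := Submodule.mem_sup.mp h1
    obtain ⟨c, rfl⟩ := mem_span_singleton'.mp hc
    have hbn : b ∈ q ^ n := pow_le_pow_right n.le_succ hb
    have hcn : ξ * c ∈ q ^ n := by
      have := sub_mem (f.2 n) hbn
      rwa [← hbc, add_sub_cancel_left, mul_comm] at this
    have hsplit : reesMonomial (f.2 n) = reesMonomial hbn + reesMonomial hcn :=
      Subtype.ext <| by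
        change monomial n _ = monomial n _ + monomial n _
        rw [← map_add, mul_comm ξ, hbc]
    have hsucc : ∀ {e} (he : e ∈ q ^ n), e ∈ q ^ (n + 1) → reesMonomial he ∈ q.reesSucc := by
      intro e he he' m
      change (monomial n e).coeff m ∈ _
      rw [coeff_monomial]
      split_ifs with hnm
      · exact hnm ▸ he'
      · exact zero_mem _
    rw [hsplit]
    refine Ideal.add_mem _ (mem_sup_left (hsucc hbn hb)) ?_
    cases n with
    | zero => exact mem_sup_left (hsucc hcn (by simpa using q.mul_mem_right c hξ))
    | succ n =>
      refine mem_sup_right (mem_span_singleton'.mpr ⟨reesMonomial (h n c hcn), Subtype.ext ?_⟩)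
      change monomial n c * monomial 1 ξ = monomial (n + 1) (ξ * c)
      rw [monomial_mul_monomial, mul_comm c]
  · rw [sup_le_iff, span_singleton_le_iff_mem]
    constructor
    · intro f hf n
      rw [coe_reesMap, coeff_map, ← Ideal.map_pow]
      exact mem_map_of_mem _ (hf n)
    · intro n
      rw [coe_reesMap, coeff_map]
      change Ideal.Quotient.mk _ ((monomial 1 ξ).coeff n) ∈ _
      rw [coeff_monomial]
      split_ifs
      · rw [Ideal.Quotient.eq_zero_iff_mem.mpr (mem_span_singleton_self ξ)]
        exact zero_mem _
      · rw [_root_.map_zero]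
        exact zero_mem _

theorem isRegularMod_reesSucc {q : Ideal R} {ξ : R} (hξ : ξ ∈ q ^ 1)
    (h : ∀ n u, ξ * u ∈ q ^ (n + 1) → u ∈ q ^ n) :
    q.reesSucc.IsRegularMod (reesMonomial hξ) := by
  intro f hf n
  refine h _ _ ?_
  have h1 := hf (n + 1)
  change (monomial 1 ξ * (f : R[X])).coeff (n + 1) ∈ _ at h1
  rwa [coeff_monomial_mul] at h1

end ReesMap

section ReesMax

variable {R S : Type*} [CommRing R] [CommRing S] [IsLocalRing R] [IsLocalRing S]

/-- The ideal of the Rees algebra of the elements whose constant coefficient is not a unit. -/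
noncomputable def reesMaximalIdeal (q : Ideal R) : Ideal (reesAlgebra q) :=
  (IsLocalRing.maximalIdeal R).comap
    ((constantCoeff (R := R)).comp (reesAlgebra q).val.toRingHom)

theorem mem_reesMaximalIdeal {q : Ideal R} {f : reesAlgebra q} :
    f ∈ q.reesMaximalIdeal ↔ (f : R[X]).coeff 0 ∈ IsLocalRing.maximalIdeal R := Iff.rfl

theorem comap_reesMap_reesMaximalIdeal (φ : R →+* S) [IsLocalHom φ] (q : Ideal R) :
    (q.map φ).reesMaximalIdeal.comap (reesMap φ q) = q.reesMaximalIdeal := by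
  ext f
  rw [mem_comap, mem_reesMaximalIdeal, mem_reesMaximalIdeal, coe_reesMap, coeff_map,
    IsLocalRing.mem_maximalIdeal, IsLocalRing.mem_maximalIdeal, map_mem_nonunits_iff]

/-- The initial form of ξ starts the sequence; the remaining members lift from the graded ring
modulo ξ. -/
theorem hasGrade_reesSucc_of_map_mk {q : Ideal R} {ξ : R} (hξ : ξ ∈ q)
    [IsLocalRing (R ⧸ span {ξ})]
    (h : ∀ n u, ξ * u ∈ q ^ (n + 1) → u ∈ q ^ n) {r : ℕ}
    (hr : (q.map (Ideal.Quotient.mk (span {ξ}))).reesMaximalIdeal.HasGrade r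
      (q.map (Ideal.Quotient.mk (span {ξ}))).reesSucc) :
    q.reesMaximalIdeal.HasGrade (r + 1) q.reesSucc := by
  have hloc : IsLocalHom (Ideal.Quotient.mk (span {ξ})) :=
    IsLocalHom.of_surjective _ Ideal.Quotient.mk_surjective
  refine ⟨reesMonomial (by rwa [pow_one]), ?_, isRegularMod_reesSucc _ h, ?_⟩
  · rw [mem_reesMaximalIdeal]
    change (monomial 1 ξ).coeff 0 ∈ _
    simp
  · rw [← comap_reesMap_reesSucc hξ h,
      ← comap_reesMap_reesMaximalIdeal (Ideal.Quotient.mk (span {ξ}))]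
    exact (hasGrade_comap_iff (reesMap_surjective Ideal.Quotient.mk_surjective q)).mpr hr

theorem reesSucc_le_reesMaximalIdeal {q : Ideal R} (hq : q ≤ IsLocalRing.maximalIdeal R) :
    q.reesSucc ≤ q.reesMaximalIdeal := fun f hf =>
  mem_reesMaximalIdeal.mpr (hq (by simpa using hf 0))

theorem le_assocGradedDepth {q : Ideal R} (hq : q ≤ IsLocalRing.maximalIdeal R) {r : ℕ}
    (h : q.reesMaximalIdeal.HasGrade r q.reesSucc) : (r : ℕ∞) ≤ q.assocGradedDepth := by
  have hcomap : q.assocGradedMaximalIdeal.comap (Ideal.Quotient.mk q.reesSucc) =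
      q.reesMaximalIdeal := by
    change (map _ q.reesMaximalIdeal).comap _ = _
    rw [comap_map_of_surjective _ Ideal.Quotient.mk_surjective, ← RingHom.ker_eq_comap_bot, mk_ker,
      sup_eq_left]
    exact reesSucc_le_reesMaximalIdeal hq
  refine HasGrade.le_regularGrade ?_ ?_
  · intro htop
    rw [htop, comap_top] at hcomap
    have h1 : (1 : reesAlgebra q) ∈ q.reesMaximalIdeal := hcomap ▸ Submodule.mem_top
    exact (IsLocalRing.maximalIdeal R).one_notMem (by simp [mem_reesMaximalIdeal] at h1)
  · rw [← hasGrade_comap_iff (Ideal.Quotient.mk_surjective (I := q.reesSucc)), hcomap,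
      ← RingHom.ker_eq_comap_bot, mk_ker]
    exact h

end ReesMax

end Ideal

/-! ### Flat base change of Rees algebras. -/

open TensorProduct

namespace Ideal

section Flat

variable {R S : Type*} [CommRing R] [CommRing S] [Algebra R S]

/-- An additive submonoid of the Rees algebra of an extended ideal that is closed under
multiplication by scalars contains every element whose coefficients lie in extensions of ideals
whose monomials belong to the submonoid. -/
theorem mem_of_forall_coeff_mem_map {q : Ideal R}
    (N : AddSubmonoid (reesAlgebra (q.map (algebraMap R S))))
    (hN : ∀ (s : S), ∀ F ∈ N, s • F ∈ N) {L : ℕ → Ideal R} (hL : ∀ n, L n ≤ q ^ n)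
    (hLN : ∀ n a (ha : a ∈ L n), reesMap (algebraMap R S) q (reesMonomial (hL n ha)) ∈ N)
    {F : reesAlgebra (q.map (algebraMap R S))}
    (hF : ∀ n, (F : S[X]).coeff n ∈ (L n).map (algebraMap R S)) : F ∈ N := by
  have key : ∀ n p, p ∈ (L n).map (algebraMap R S) →
      ∃ hp : p ∈ q.map (algebraMap R S) ^ n, reesMonomial hp ∈ N := by
    intro n p hp
    induction hp using Submodule.span_induction with
    | mem p hp =>
      obtain ⟨a, ha, rfl⟩ := hp
      have := hLN n a ha
      rw [reesMap_reesMonomial] at this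
      exact ⟨_, this⟩
    | zero =>
      refine ⟨zero_mem _, ?_⟩
      convert N.zero_mem
      exact Subtype.ext (monomial_zero_right n)
    | add x y _ _ hx hy =>
      obtain ⟨hx, hxN⟩ := hx
      obtain ⟨hy, hyN⟩ := hy
      refine ⟨add_mem hx hy, ?_⟩
      convert N.add_mem hxN hyN
      exact Subtype.ext (map_add _ _ _)
    | smul s x _ hx =>
      obtain ⟨hx, hxN⟩ := hx
      refine ⟨Ideal.mul_mem_left _ s hx, ?_⟩
      convert hN s _ hxN
      exact Subtype.ext (smul_monomial s n x).symm
  rw [eq_sum_reesMonomial F]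
  exact _root_.sum_mem fun n _ => (key n _ (hF n)).2

variable (S) in
/-- The canonical map from the base change of a Rees algebra to the Rees algebra of the extended
ideal. -/
noncomputable def reesBaseChange (q : Ideal R) :
    letI := (reesMap (algebraMap R S) q).toAlgebra
    (reesAlgebra q ⊗[R] S) →ₗ[reesAlgebra q] reesAlgebra (q.map (algebraMap R S)) :=
  letI := (reesMap (algebraMap R S) q).toAlgebra
  haveI : IsScalarTower R (reesAlgebra q) (reesAlgebra (q.map (algebraMap R S))) :=
    .of_algebraMap_eq fun r => Subtype.ext <| by
      change algebraMap R S[X] r = Polynomial.map _ (C r)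
      rw [map_C]
      rfl
  (Algebra.TensorProduct.productLeftAlgHom (Algebra.ofId _ _)
    (IsScalarTower.toAlgHom R S _)).toLinearMap

theorem reesBaseChange_tmul (q : Ideal R) (f : reesAlgebra q) (s : S) :
    reesBaseChange S q (f ⊗ₜ s) = s • reesMap (algebraMap R S) q f := by
  change reesMap (algebraMap R S) q f * algebraMap S _ s = _
  rw [Algebra.smul_def, mul_comm]

/-- Flatness keeps the inclusion of the Rees algebra in R[X] injective after tensoring, and the
target becomes S[X]. -/
theorem reesBaseChange_injective [Module.Flat R S] (q : Ideal R) :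
    Function.Injective (reesBaseChange S q) := by
  let Θ : (reesAlgebra q ⊗[R] S) →+ S[X] :=
    ((polyEquivTensor R S).symm.toAddEquiv.toAddMonoidHom.comp
      (TensorProduct.comm R R[X] S).toAddEquiv.toAddMonoidHom).comp
      ((reesAlgebra q).val.toLinearMap.rTensor S).toAddMonoidHom
  have hΘ : Function.Injective Θ :=
    ((polyEquivTensor R S).symm.injective.comp (TensorProduct.comm R R[X] S).injective).comp
      (Module.Flat.rTensor_preserves_injective_linearMap _ Subtype.val_injective)
  have heq : ∀ z, (reesBaseChange S q z : S[X]) = Θ z := by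
    intro z
    induction z using TensorProduct.induction_on with
    | zero => simp
    | tmul f s =>
      rw [reesBaseChange_tmul]
      exact (polyEquivTensor_symm_apply_tmul_eq_smul R S s (f : R[X])).symm
    | add x y hx hy => rw [map_add, map_add, ← hx, ← hy]; rfl
  intro z w hzw
  exact hΘ (by rw [← heq, ← heq, hzw])

theorem reesBaseChange_surjective (q : Ideal R) :
    Function.Surjective (reesBaseChange S q) := by
  intro F
  refine mem_of_forall_coeff_mem_map (AddMonoidHom.mrange (reesBaseChange S q).toAddMonoidHom) ?_
    (L := fun n => q ^ n) (fun n => le_rfl) ?_ (fun n => by rw [Ideal.map_pow]; exact F.2 n)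
  · rintro s _ ⟨z, rfl⟩
    induction z using TensorProduct.induction_on with
    | zero => exact ⟨0, by simp⟩
    | tmul f t =>
      refine ⟨f ⊗ₜ (s * t), ?_⟩
      rw [LinearMap.toAddMonoidHom_coe, reesBaseChange_tmul, reesBaseChange_tmul, mul_smul]
    | add x y hx hy =>
      rw [map_add, smul_add]
      exact add_mem hx hy
  · intro n a ha
    refine ⟨reesMonomial ha ⊗ₜ 1, ?_⟩
    rw [LinearMap.toAddMonoidHom_coe, reesBaseChange_tmul, one_smul]

theorem faithfullyFlat_reesMap [Module.FaithfullyFlat R S] (q : Ideal R) :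
    letI := (reesMap (algebraMap R S) q).toAlgebra
    Module.FaithfullyFlat (reesAlgebra q) (reesAlgebra (q.map (algebraMap R S))) := by
  let _ := (reesMap (algebraMap R S) q).toAlgebra
  exact Module.FaithfullyFlat.of_linearEquiv (reesAlgebra q) (reesAlgebra q ⊗[R] S)
    (LinearEquiv.ofBijective (reesBaseChange S q)
      ⟨reesBaseChange_injective q, reesBaseChange_surjective q⟩).symm

theorem map_reesMap_reesSucc (q : Ideal R) :
    q.reesSucc.map (reesMap (algebraMap R S) q) = (q.map (algebraMap R S)).reesSucc := by
  apply le_antisymm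
  · refine map_le_iff_le_comap.mpr fun f hf n => ?_
    rw [coe_reesMap, coeff_map, ← Ideal.map_pow]
    exact mem_map_of_mem _ (hf n)
  · intro F hF
    refine mem_of_forall_coeff_mem_map
      (q.reesSucc.map (reesMap (algebraMap R S) q)).toAddSubmonoid ?_
      (L := fun n => q ^ (n + 1)) (fun n => pow_le_pow_right n.le_succ) ?_
      (fun n => by rw [Ideal.map_pow]; exact hF n)
    · intro s G hG
      rw [Algebra.smul_def]
      exact Ideal.mul_mem_left _ _ hG
    · intro n a ha
      refine mem_map_of_mem _ fun m => ?_
      change (monomial n a).coeff m ∈ _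
      rw [coeff_monomial]
      split_ifs with hnm
      · exact hnm ▸ ha
      · exact zero_mem _

theorem reesMaximalIdeal_le_map [IsLocalRing R] [IsLocalRing S]
    (hm : (IsLocalRing.maximalIdeal R).map (algebraMap R S) = IsLocalRing.maximalIdeal S)
    (q : Ideal R) :
    (q.map (algebraMap R S)).reesMaximalIdeal ≤
      q.reesMaximalIdeal.map (reesMap (algebraMap R S) q) := by
  intro F hF
  refine mem_of_forall_coeff_mem_map
    (q.reesMaximalIdeal.map (reesMap (algebraMap R S) q)).toAddSubmonoid ?_
    (L := fun n => if n = 0 then IsLocalRing.maximalIdeal R else q ^ n) ?_ ?_ ?_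
  · intro s G hG
    rw [Algebra.smul_def]
    exact Ideal.mul_mem_left _ _ hG
  · rintro (_ | n)
    · simp
    · simp
  · intro n a ha
    refine mem_map_of_mem _ ?_
    rw [mem_reesMaximalIdeal]
    change (monomial n a).coeff 0 ∈ _
    rw [coeff_monomial]
    split_ifs with hn
    · simpa [hn] using ha
    · exact zero_mem _
  · rintro (_ | n)
    · rw [if_pos rfl, hm]
      exact mem_reesMaximalIdeal.mp hF
    · simpa [Ideal.map_pow] using F.2 (n + 1)

/-- The extension of Rees algebras is a base change of `R → S`, hence faithfully flat, so grade
descends along it. -/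
theorem HasGrade.of_map_reesSucc [IsLocalRing R] [IsLocalRing S] [IsNoetherianRing R]
    [IsNoetherianRing S] [Module.FaithfullyFlat R S]
    (hm : (IsLocalRing.maximalIdeal R).map (algebraMap R S) = IsLocalRing.maximalIdeal S)
    {q : Ideal R} {r : ℕ}
    (h : (q.map (algebraMap R S)).reesMaximalIdeal.HasGrade r (q.map (algebraMap R S)).reesSucc) :
    q.reesMaximalIdeal.HasGrade r q.reesSucc := by
  let _ := (reesMap (algebraMap R S) q).toAlgebra
  have := faithfullyFlat_reesMap (S := S) q
  refine HasGrade.of_map (C := reesAlgebra (q.map (algebraMap R S))) ?_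
  rw [← map_reesMap_reesSucc] at h
  exact h.mono_left (reesMaximalIdeal_le_map hm q)

end Flat

end Ideal

/-! ### Superficial elements and Sally's descent. -/

namespace Ideal

section Colon

theorem IsRegularMod.pow {A : Type*} [CommRing A] {I : Ideal A} {x : A} (hx : I.IsRegularMod x)
    (n : ℕ) : I.IsRegularMod (x ^ n) := by
  induction n with
  | zero => exact fun a ha => by simpa using ha
  | succ n ih => exact fun a ha => hx _ (ih _ (by rwa [← mul_assoc, ← pow_succ]))

/-- If the graded ring of `q` has positive depth, no nonzero element of it is annihilated by its
elements of degree one. -/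
theorem mem_pow_of_hasGrade_reesSucc {R : Type*} [CommRing R] [IsLocalRing R] {q : Ideal R} {k : ℕ}
    (hk : IsLocalRing.maximalIdeal R ^ k ≤ q) (h : q.reesMaximalIdeal.HasGrade 1 q.reesSucc)
    (n : ℕ) (u : R) (hu : ∀ y ∈ q, y * u ∈ q ^ (n + 1)) : u ∈ q ^ n := by
  obtain ⟨z, hz, hreg, -⟩ := h
  suffices ∀ j ≤ n, u ∈ q ^ j from this n le_rfl
  intro j
  induction j with
  | zero => simp
  | succ j ih =>
    intro hj
    have huj := ih (by omega)
    have hmon : ∀ m, (monomial (R := R) j u).coeff m ∈ q ^ m := fun m =>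
      (reesMonomial huj).2 m
    -- Each homogeneous component of an element here has a power annihilating the class of u T^j: in
    -- degree zero because m^k ≤ q, in positive degree by the colon condition on `u` and j < n. A
    -- regular element then forces that class to vanish.
    have hle : q.reesMaximalIdeal ≤ (q.reesSucc.colon {reesMonomial huj}).radical := by
      intro g hg
      rw [eq_sum_reesMonomial g]
      refine Ideal.sum_mem _ fun i _ => ?_
      have hmem : ∀ (i : ℕ) (b : R) (hb : b ∈ q ^ i), b * u ∈ q ^ (i + j + 1) →
          reesMonomial hb ∈ q.reesSucc.colon {reesMonomial huj} := by
        intro i b hb hbu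
        rw [Submodule.mem_colon_singleton]
        intro m
        change (monomial i b * monomial j u).coeff m ∈ _
        rw [monomial_mul_monomial, coeff_monomial]
        split_ifs with hm
        · exact hm ▸ hbu
        · exact zero_mem _
      cases i with
      | zero =>
        refine ⟨k, ?_⟩
        have hpow : (g : R[X]).coeff 0 ^ k ∈ q := hk (pow_mem_pow (mem_reesMaximalIdeal.mp hg) k)
        have heq : reesMonomial (g.2 0) ^ k =
            reesMonomial (q := q) (n := 0) (a := (g : R[X]).coeff 0 ^ k) (by simp) :=
          Subtype.ext <| by
            change (monomial 0 _) ^ k = monomial 0 _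
            rw [monomial_pow, zero_mul]
        rw [heq]
        refine hmem _ _ _ ?_
        rw [zero_add, pow_succ']
        exact mul_mem_mul hpow huj
      | succ i =>
        refine le_radical (hmem _ _ _ ?_)
        exact pow_le_pow_right (by omega) (mul_mem_pow_add_of_forall_mul_mem (g.2 (i + 1)) hu)
    obtain ⟨N, hN⟩ := hle hz
    have := hreg.pow N _ (Submodule.mem_colon_singleton.mp hN) j
    change (monomial j u).coeff j ∈ _ at this
    simpa using this

/-- A form of Sally's descent: if `ξ * u ∈ q ^ (n + 1)` implies `u ∈ q ^ n` for all large `n` and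
the graded ring of `q` modulo `ξ` has positive depth, then the implication holds for all `n`. -/
theorem mem_pow_of_mul_mem_of_map_mk {S : Type*} [CommRing S] {q : Ideal S} {ξ : S} {c : ℕ}
    (hξ : ξ ∈ q) (hc : ∀ n, c ≤ n → ∀ u, ξ * u ∈ q ^ (n + 1) → u ∈ q ^ n)
    (hmod : ∀ n u, (∀ y ∈ q.map (Ideal.Quotient.mk (span {ξ})),
      y * u ∈ q.map (Ideal.Quotient.mk (span {ξ})) ^ (n + 1)) →
      u ∈ q.map (Ideal.Quotient.mk (span {ξ})) ^ n)
    (n : ℕ) (u : S) (hu : ξ * u ∈ q ^ (n + 1)) : u ∈ q ^ n := by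
  have hc' : ∀ j n, c ≤ n → ∀ u, ξ ^ j * u ∈ q ^ (n + j) → u ∈ q ^ n := by
    intro j
    induction j with
    | zero => intro n _ u hu; simpa using hu
    | succ j ih =>
      intro n hn u hu
      exact ih n hn u (hc _ (by omega) _ (by rwa [← mul_assoc, ← pow_succ']))
  have hmod' : ∀ p n u, (∀ y ∈ q.map (Ideal.Quotient.mk (span {ξ})) ^ p,
      y * u ∈ q.map (Ideal.Quotient.mk (span {ξ})) ^ (n + p)) →
      u ∈ q.map (Ideal.Quotient.mk (span {ξ})) ^ n := by
    intro p
    induction p with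
    | zero => intro n u hu; simpa using hu 1
    | succ p ih =>
      intro n u hu
      refine ih n u fun y hy => hmod _ _ fun z hz => ?_
      rw [← mul_assoc]
      exact hu _ (by rw [pow_succ']; exact mul_mem_mul hz hy)
  -- All powers of ξ are treated together, since the induction step on `n` passes from j to j + 1.
  suffices ∀ n j u, ξ ^ j * u ∈ q ^ (n + j) → u ∈ q ^ n from this n 1 u (by rwa [pow_one])
  intro n
  induction n with
  | zero => simp
  | succ n ih =>
    intro j u hu
    -- Multiplying by q^c moves into degrees at least c, where ξ^j may be cancelled; the colon
    -- condition modulo ξ then removes q^c.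
    have h1 : Ideal.Quotient.mk (span {ξ}) u ∈ q.map (Ideal.Quotient.mk (span {ξ})) ^ (n + 1) := by
      refine hmod' c _ _ fun y hy => ?_
      rw [← Ideal.map_pow] at hy
      obtain ⟨y, hyc, rfl⟩ := (mem_map_iff_of_surjective _ Ideal.Quotient.mk_surjective).mp hy
      rw [← _root_.map_mul, ← Ideal.map_pow]
      refine mem_map_of_mem _ (hc' j _ (by omega) _ ?_)
      rw [mul_left_comm, show n + 1 + c + j = c + (n + 1 + j) by omega, pow_add q c]
      exact mul_mem_mul hyc hu
    rw [← Ideal.map_pow, ← mem_comap, comap_map_of_surjective _ Ideal.Quotient.mk_surjective,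
      ← RingHom.ker_eq_comap_bot, mk_ker] at h1
    obtain ⟨v, hv, w, hw, rfl⟩ := Submodule.mem_sup.mp h1
    obtain ⟨w, rfl⟩ := mem_span_singleton'.mp hw
    have h2 : ξ ^ (j + 1) * w ∈ q ^ (n + (j + 1)) := by
      have h3 : ξ ^ j * v ∈ q ^ (n + 1 + j) := by
        rw [mul_comm, pow_add]
        exact mul_mem_mul hv (pow_mem_pow hξ j)
      have h4 := sub_mem hu h3
      rw [show n + (j + 1) = n + 1 + j by omega]
      convert h4 using 1
      ring
    rw [pow_succ]
    exact add_mem (by rwa [← pow_succ]) (mul_mem_mul (ih _ _ h2) hξ)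

theorem forall_mul_mem_of_forall_range {A ι : Type*} [CommRing A] {x : ι → A} {I : Ideal A} {u : A}
    (h : ∀ i, x i * u ∈ I) : ∀ y ∈ span (Set.range x), y * u ∈ I := by
  have : span (Set.range x) ≤ I.colon {u} := span_le.mpr <| by
    rintro _ ⟨i, rfl⟩
    exact Submodule.mem_colon_singleton.mpr (h i)
  exact fun y hy => Submodule.mem_colon_singleton.mp (this hy)

end Colon

/-! ### Cutting down the number of generators. -/

theorem maximalIdeal_pow_le_map {A B : Type*} [CommRing A] [CommRing B] [IsLocalRing A]
    [IsLocalRing B] {φ : A →+* B}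
    (h : (IsLocalRing.maximalIdeal A).map φ = IsLocalRing.maximalIdeal B) {q : Ideal A} {k : ℕ}
    (hk : IsLocalRing.maximalIdeal A ^ k ≤ q) : IsLocalRing.maximalIdeal B ^ k ≤ q.map φ := by
  rw [← h, ← Ideal.map_pow]
  exact map_mono hk

open IsLocalRing in
/-- Reduction of the number of generators of an ideal primary to the maximal ideal by means of a
superficial element of a flat local extension. -/
theorem exists_reduction_of_superficial.{u} {R E : Type u} [CommRing R] [IsLocalRing R]
    [IsNoetherianRing R] [CommRing E] [IsLocalRing E] [IsNoetherianRing E] [Algebra R E]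
    [IsLocalHom (algebraMap R E)] [Module.Flat R E]
    (hm : (maximalIdeal R).map (algebraMap R E) = maximalIdeal E)
    {c d k r : ℕ} {q : Ideal R} (x : Fin d → E) {ξ : E}
    (hQ : q.map (algebraMap R E) = span {ξ} ⊔ span (Set.range x))
    (hqm : q ≤ maximalIdeal R) (hk : maximalIdeal R ^ k ≤ q)
    (hgrade : (maximalIdeal R).HasGrade (r + 1) ⊥) (hξreg : (⊥ : Ideal E).IsRegularMod ξ)
    (hξc : ∀ n, c ≤ n → ∀ u, ξ * u ∈ q.map (algebraMap R E) ^ (n + 1) →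
      u ∈ q.map (algebraMap R E) ^ n) :
    ∃ (S : Type u) (_ : CommRing S) (_ : IsLocalRing S) (_ : IsNoetherianRing S) (x' : Fin d → S)
      (q' : Ideal S), q' = span (Set.range x') ∧ q' ≤ maximalIdeal S ∧ maximalIdeal S ^ k ≤ q' ∧
      (maximalIdeal S).HasGrade r ⊥ ∧
      (∀ n : ℕ, q.hilbertFunction (n + 1) - q.hilbertFunction n ≤ q'.hilbertFunction (n + 1)) ∧
      (∃ c, ∀ n : ℕ, c ≤ n →
        q.hilbertFunction (n + 1) - q.hilbertFunction n = q'.hilbertFunction (n + 1)) ∧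
      ((∀ n : ℕ, q.hilbertFunction (n + 1) - q.hilbertFunction n = q'.hilbertFunction (n + 1)) →
        ∀ s, q'.reesMaximalIdeal.HasGrade s q'.reesSucc →
          q.reesMaximalIdeal.HasGrade (s + 1) q.reesSucc) ∧
      (q'.reesMaximalIdeal.HasGrade 1 q'.reesSucc → ∀ n : ℕ,
        q.hilbertFunction (n + 1) - q.hilbertFunction n = q'.hilbertFunction (n + 1)) := by
  set Q : Ideal E := q.map (algebraMap R E) with hQdef
  have hff : Module.FaithfullyFlat R E := Module.FaithfullyFlat.of_flat_of_isLocalHom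
  have hξQ : ξ ∈ Q := hQ ▸ mem_sup_left (mem_span_singleton_self ξ)
  have hQm : Q ≤ maximalIdeal E := hm ▸ map_mono hqm
  have hkQ : maximalIdeal E ^ k ≤ Q := maximalIdeal_pow_le_map hm hk
  have hfin : ∀ n, Module.length E (E ⧸ Q ^ n) ≠ ⊤ := fun n =>
    length_quotient_ne_top (k := k * n) (by rw [pow_mul]; exact pow_right_mono hkQ n)
  have hH : ∀ n, Q.hilbertFunction n = q.hilbertFunction n := hilbertFunction_map_of_flat hm q
  have hnontriv : Nontrivial (E ⧸ span {ξ}) := Ideal.Quotient.nontrivial_iff.mpr fun h =>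
    (maximalIdeal.isMaximal E).ne_top (top_le_iff.mp (h ▸
      (span_singleton_le_iff_mem _).mpr (hQm hξQ)))
  have hlocal : IsLocalRing (E ⧸ span {ξ}) :=
    IsLocalRing.of_surjective' _ Ideal.Quotient.mk_surjective
  have hlochom : IsLocalHom (Ideal.Quotient.mk (span {ξ})) :=
    IsLocalHom.of_surjective _ Ideal.Quotient.mk_surjective
  have hcomap : (maximalIdeal (E ⧸ span {ξ})).comap (Ideal.Quotient.mk (span {ξ})) =
      maximalIdeal E := maximalIdeal_comap _
  have hm' : maximalIdeal (E ⧸ span {ξ}) =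
      (maximalIdeal E).map (Ideal.Quotient.mk (span {ξ})) := by
    rw [← hcomap, map_comap_of_surjective _ Ideal.Quotient.mk_surjective]
  have hkQ' : maximalIdeal (E ⧸ span {ξ}) ^ k ≤ Q.map (Ideal.Quotient.mk (span {ξ})) := 
    maximalIdeal_pow_le_map hm'.symm hkQ
  have hiff := hilbertFunction_add_one_sub_le hfin hξQ
  simp only [hH] at hiff
  refine ⟨E ⧸ span {ξ}, inferInstance, hlocal, inferInstance,
    fun i => Ideal.Quotient.mk _ (x i), Q.map (Ideal.Quotient.mk (span {ξ})),
    ?_, ?_, ?_, ?_, fun n => (hiff n).1, ⟨c, fun n hn => (hiff n).2.mpr (hξc n hn)⟩, ?_, ?_⟩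
  · rw [hQ, map_sup, map_span, map_span, Set.image_singleton,
      Ideal.Quotient.eq_zero_iff_mem.mpr (mem_span_singleton_self ξ), span_singleton_eq_bot.mpr rfl,
      bot_sup_eq, ← Set.range_comp]
    rfl
  · rw [hm']
    exact map_mono hQm
  · exact hkQ'
  -- The grade drops by only one because any nonzerodivisor can start a regular sequence of the
  -- given length.
  · have h1 := hgrade.map_of_flat (C := E)
    rw [hm, Ideal.map_bot] at h1
    have h2 := h1.sup_span_singleton (hQm hξQ) hξreg
    rw [← hasGrade_comap_iff (Ideal.Quotient.mk_surjective (I := span {ξ})), hcomap,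
      ← RingHom.ker_eq_comap_bot, mk_ker]
    rwa [bot_sup_eq] at h2
  · intro h s hs
    exact (hasGrade_reesSucc_of_map_mk hξQ (fun n => (hiff n).2.mp (h n)) hs).of_map_reesSucc hm
  · intro h n
    refine (hiff n).2.mpr (mem_pow_of_mul_mem_of_map_mk hξQ hξc ?_ n)
    exact mem_pow_of_hasGrade_reesSucc hkQ' h

open IsLocalRing in
/-- An ideal primary to the maximal ideal of a local ring of positive depth is cut down by a
superficial element of a flat local extension. -/
theorem exists_superficial_reduction.{u} {R : Type u} [CommRing R] [IsLocalRing R]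
    [IsNoetherianRing R]
    {d k r : ℕ} {q : Ideal R} (x : Fin (d + 1) → R) (hx : q = span (Set.range x))
    (hqm : q ≤ maximalIdeal R) (hk : maximalIdeal R ^ k ≤ q)
    (hgrade : (maximalIdeal R).HasGrade (r + 1) ⊥) :
    ∃ (S : Type u) (_ : CommRing S) (_ : IsLocalRing S) (_ : IsNoetherianRing S) (x' : Fin d → S)
      (q' : Ideal S), q' = span (Set.range x') ∧ q' ≤ maximalIdeal S ∧ maximalIdeal S ^ k ≤ q' ∧
      (maximalIdeal S).HasGrade r ⊥ ∧
      (∀ n : ℕ, q.hilbertFunction (n + 1) - q.hilbertFunction n ≤ q'.hilbertFunction (n + 1)) ∧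
      (∃ c, ∀ n : ℕ, c ≤ n →
        q.hilbertFunction (n + 1) - q.hilbertFunction n = q'.hilbertFunction (n + 1)) ∧
      ((∀ n : ℕ, q.hilbertFunction (n + 1) - q.hilbertFunction n = q'.hilbertFunction (n + 1)) →
        ∀ s, q'.reesMaximalIdeal.HasGrade s q'.reesSucc →
          q.reesMaximalIdeal.HasGrade (s + 1) q.reesSucc) ∧
      (q'.reesMaximalIdeal.HasGrade 1 q'.reesSucc → ∀ n : ℕ,
        q.hilbertFunction (n + 1) - q.hilbertFunction n = q'.hilbertFunction (n + 1)) := by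
  obtain ⟨y, hym, hyreg, -⟩ := id hgrade
  have hyq : y ^ k ∈ q := hk (pow_mem_pow hym k)
  obtain ⟨c, hc⟩ := exists_forall_mem_pow_of_mul_mem hyq (hyreg.pow k)
  have hxq : ∀ i, x i ∈ q := fun i => hx ▸ subset_span ⟨i, rfl⟩
  have hm : (maximalIdeal R).map (algebraMap R (GaussExtension R)) =
      maximalIdeal (GaussExtension R) := maximalIdeal_gaussExtension R
  have hQ : q.map (algebraMap R (GaussExtension R)) = span {gaussElement x} ⊔
      span (Set.range fun i : Fin d => algebraMap R (GaussExtension R) (x i.succ)) := by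
    rw [← map_span_range_eq_gaussElement, ← hx]
  have hξreg : (⊥ : Ideal (GaussExtension R)).IsRegularMod (gaussElement x) := by
    intro u hu
    have := mem_map_of_gaussElement_mul_mem (x := x) (K := fun _ => ⊥)
      (fun n i u hu => by simp [(mem_bot.mp hu)]) (fun n u hu => hyreg.pow k _
        (forall_mul_mem_of_forall_range hu _ (hx ▸ hyq))) 0 u (by rwa [Ideal.map_bot])
    rwa [Ideal.map_bot] at this
  have hξc : ∀ n, c ≤ n → ∀ u,
      gaussElement x * u ∈ q.map (algebraMap R (GaussExtension R)) ^ (n + 1) →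
        u ∈ q.map (algebraMap R (GaussExtension R)) ^ n := by
    intro n hn u hu
    -- Shifting the filtration by `c` makes the colon condition hold at every level.
    have := mem_map_of_gaussElement_mul_mem (x := x) (K := fun n => q ^ (n + c))
      (fun n i u hu => by
        rw [show n + 1 + c = (n + c) + 1 by omega, pow_succ']
        exact mul_mem_mul (hxq i) hu)
      (fun n u hu => hc _ (by omega) u fun y hy => by
        rw [show n + c + 1 = n + 1 + c by omega]
        exact forall_mul_mem_of_forall_range hu y (hx ▸ hy)) (n - c) u (by
          rw [show n - c + 1 + c = n + 1 by omega, Ideal.map_pow]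
          exact hu)
    rwa [show n - c + c = n by omega, Ideal.map_pow] at this
  exact exists_reduction_of_superficial hm _ hQ hqm hk hgrade hξreg hξc

end Ideal

/-! ### Values and sums of Hilbert polynomials. -/

open Filter

theorem Int.choose_neg_one (k : ℕ) : Ring.choose (-1 : ℤ) k = (-1) ^ k := by
  induction k with
  | zero => simp
  | succ k ih =>
    have h := Ring.choose_succ_succ (-1 : ℤ) k
    rw [neg_add_cancel, Ring.choose_zero_succ, ih] at h
    rw [pow_succ]
    linarith

theorem hilbertSum_congr {d : ℕ} {e e' : ℕ → ℤ} (h : ∀ i ≤ d, e i = e' i) (n : ℤ) :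
    hilbertSum d e n = hilbertSum d e' n :=
  Finset.sum_congr rfl fun i hi => by rw [h i (Nat.lt_succ_iff.mp (Finset.mem_range.mp hi))]

/-- At n = -k the terms with i < d - k have binomials with 0 ≤ top < bottom, which vanish, and the
term i = d - k has binom(-1, k) = (-1)^k. This makes the values at 0, -1, … triangular in e_d,
e_(d-1), …. -/
theorem hilbertSum_neg {d k : ℕ} (hk : k ≤ d) {e : ℕ → ℤ} (h : ∀ i, d - k < i → i ≤ d → e i = 0) :
    hilbertSum d e (-(k : ℤ)) = (-1) ^ d * e (d - k) := by
  unfold hilbertSum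
  rw [Finset.sum_eq_single (d - k)]
  · have h1 : (-(k : ℤ) + d - (d - k : ℕ) - 1) = -1 := by
      rw [Nat.cast_sub hk]; ring
    have h2 : d - (d - k) = k := by omega
    have h3 : (-1 : ℤ) ^ d = (-1) ^ (d - k) * (-1) ^ k := by
      rw [← pow_add, Nat.sub_add_cancel hk]
    rw [h1, h2, Int.choose_neg_one, h3]
    ring
  · intro i hi hne
    have hid : i ≤ d := Nat.lt_succ_iff.mp (Finset.mem_range.mp hi)
    rcases lt_or_gt_of_ne hne with hlt | hgt
    · obtain ⟨m, hm⟩ : ∃ m : ℕ, d = k + i + 1 + m := ⟨d - k - i - 1, by omega⟩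
      have h1 : (-(k : ℤ) + d - i - 1) = (m : ℕ) := by
        rw [hm]; push_cast; ring
      rw [h1, Ring.choose_natCast, Nat.choose_eq_zero_of_lt (by omega)]
      simp
    · rw [h i hgt hid]
      simp
  · intro h
    exact absurd (Finset.mem_range.mpr (by omega)) h

theorem eq_zero_of_hilbertSum_neg {d K : ℕ} (hK : K ≤ d) {e : ℕ → ℤ}
    (h : ∀ k ≤ K, hilbertSum d e (-(k : ℤ)) = 0) : ∀ k ≤ K, e (d - k) = 0 := by
  intro k
  induction k using Nat.strong_induction_on with
  | _ k ih =>
    intro hk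
    have h1 := hilbertSum_neg (d := d) (k := k) (e := e) (by omega) fun i hi hid => by
      have := ih (d - i) (by omega) (by omega)
      rwa [show d - (d - i) = i by omega] at this
    rw [h k hk] at h1
    simpa using h1.symm

/-- Summing the difference equation leaves one free constant, the last coefficient, which is fixed
by matching `H` at a single large `M`. -/
theorem exists_hilbertSum_extension {d : ℕ} {e' : ℕ → ℤ} {H H' : ℤ → ℤ} {c : ℕ}
    (h : ∀ n : ℕ, c ≤ n → H (n + 1) - H n = H' (n + 1))
    (h' : ∀ᶠ n : ℤ in atTop, H' n = hilbertSum d e' n) :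
    ∃ e : ℕ → ℤ, (∀ i ≤ d, e i = e' i) ∧ ∀ᶠ n : ℤ in atTop, H n = hilbertSum (d + 1) e n := by
  obtain ⟨N, hN⟩ := eventually_atTop.mp h'
  obtain ⟨M, hM⟩ : ∃ M : ℕ, c ≤ M ∧ N ≤ M := ⟨max c N.toNat, le_max_left _ _, by omega⟩
  have hsucc : ∀ a : ℤ, hilbertSum (d + 1) (Function.update e' (d + 1) a) M =
      hilbertSum (d + 1) (Function.update e' (d + 1) 0) M + (-1) ^ (d + 1) * a := by
    intro a
    unfold hilbertSum
    rw [Finset.sum_range_succ _ (d + 1), Finset.sum_range_succ _ (d + 1)]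
    simp only [Function.update_self, Nat.sub_self, Ring.choose_zero_right, mul_one, mul_zero,
      add_zero, add_left_inj]
    refine Finset.sum_congr rfl fun i hi => ?_
    have : i ≠ d + 1 := (Finset.mem_range.mp hi).ne
    rw [Function.update_of_ne this, Function.update_of_ne this]
  set a := (-1) ^ (d + 1) * (H M - hilbertSum (d + 1) (Function.update e' (d + 1) 0) M) with ha
  set e := Function.update e' (d + 1) a
  have he : ∀ i ≤ d, e i = e' i := fun i hi => Function.update_of_ne (by omega) _ _
  refine ⟨e, he, eventually_atTop.mpr ⟨M, fun n hn => ?_⟩⟩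
  induction n, hn using Int.leInduction with
  | base =>
    rw [hsucc, ha, ← mul_assoc, ← mul_pow]
    simp
  | succ n hn ih =>
    have h1 := hilbertSum_add_one_sub d e n
    have h2 := h n.toNat (by omega)
    rw [Int.toNat_of_nonneg (by omega), hN _ (by omega)] at h2
    rw [hilbertSum_congr he] at h1
    linarith

/-! ### The induction on the number of generators. -/

namespace Ideal

/-- For principal q, q^n/q^(n+1) is R/(q^(n+1) : y^n), whose length is nonincreasing in n and so
stabilizes at its minimum. Hence P - H is nonincreasing and eventually 0, even if y is a
zerodivisor. -/
theorem exists_hilbertSum_one {R : Type*} [CommRing R] {q : Ideal R} {y : R} (hq : q = span {y})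
    (hfin : ∀ n, Module.length R (R ⧸ q ^ n) ≠ ⊤) :
    ∃ e : ℕ → ℤ, (∀ᶠ n : ℤ in atTop, q.hilbertFunction n = hilbertSum 1 e n) ∧
      ∀ n : ℕ, q.hilbertFunction n ≤ hilbertSum 1 e n := by
  set b : ℕ → ℕ := fun n => (Module.length R (R ⧸ (q ^ (n + 1)).colon {y ^ n})).toNat with hb
  have hyq : y ∈ q := hq ▸ mem_span_singleton_self y
  have hadd : ∀ n, Module.length R (R ⧸ q ^ (n + 1)) =
      Module.length R (R ⧸ (q ^ (n + 1)).colon {y ^ n}) + Module.length R (R ⧸ q ^ n) := by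
    intro n
    have : q ^ (n + 1) ⊔ span {y ^ n} = q ^ n := by
      rw [← span_singleton_pow, ← hq]
      exact sup_eq_right.mpr (pow_le_pow_right n.le_succ)
    rw [length_quotient_eq_add (q ^ (n + 1)) (y ^ n), this]
  have hne : ∀ n, Module.length R (R ⧸ (q ^ (n + 1)).colon {y ^ n}) ≠ ⊤ := fun n htop =>
    hfin (n + 1) (by rw [hadd, htop, top_add])
  have hH : ∀ n : ℕ, q.hilbertFunction (n + 1) - q.hilbertFunction n = b n := by
    intro n
    have h1 := hilbertFunction_natCast q (n + 1)
    push_cast at h1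
    rw [h1, hilbertFunction_natCast, hadd, ENat.toNat_add (hne n) (hfin n)]
    push_cast
    ring
  have hanti : Antitone b := antitone_nat_of_succ_le fun n => by
    refine ENat.toNat_le_toNat (length_quotient_le_of_le fun a ha => ?_) (hne n)
    rw [Submodule.mem_colon_singleton] at ha ⊢
    have : a • y ^ (n + 1) = (a • y ^ n) * y := by simp only [smul_eq_mul]; ring
    rw [this, pow_succ _ (n + 1)]
    exact mul_mem_mul ha hyq
  obtain ⟨N, hN⟩ := Nat.sInf_mem (Set.range_nonempty b)
  have hconst : ∀ n, N ≤ n → b n = b N := fun n hn =>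
    le_antisymm (hanti hn) (hN ▸ Nat.sInf_le ⟨n, rfl⟩)
  obtain ⟨e, he, hev⟩ := exists_hilbertSum_extension (d := 0) (e' := fun _ => (b N : ℤ))
    (H := q.hilbertFunction) (H' := fun _ => (b N : ℤ)) (c := N)
    (fun n hn => by rw [hH, hconst n hn]) (Eventually.of_forall fun n => by simp [hilbertSum])
  refine ⟨e, hev, fun n => ?_⟩
  obtain ⟨M, hM⟩ := eventually_atTop.mp hev
  have hstep : Antitone fun n : ℕ => hilbertSum 1 e n - q.hilbertFunction n := by
    refine antitone_nat_of_succ_le fun n => ?_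
    have h1 := hilbertSum_add_one_sub 0 e n
    rw [hilbertSum_congr he] at h1
    have h2 : hilbertSum 0 (fun _ => (b N : ℤ)) (n + 1) = b N := by simp [hilbertSum]
    have h3 := hH n
    have h4 : (b N : ℤ) ≤ b n := Nat.cast_le.mpr (hN.trans_le (Nat.sInf_le ⟨n, rfl⟩))
    push_cast
    linarith
  have h5 := hstep (le_max_left n M.toNat)
  have h6 := hM (max n M.toNat : ℕ) (by omega)
  simp only at h5
  linarith

open IsLocalRing in
-- Counting generators instead of dimension lets the induction avoid tracking dimension through the
-- cut.
theorem exists_hilbertSum_of_hasGrade.{u} (d : ℕ) : ∀ {R : Type u} [CommRing R] [IsLocalRing R]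
    [IsNoetherianRing R] {q : Ideal R} {k : ℕ} (x : Fin (d + 2) → R),
    q = span (Set.range x) → q ≤ maximalIdeal R → maximalIdeal R ^ k ≤ q →
    (maximalIdeal R).HasGrade (d + 1) ⊥ →
    ∃ e : ℕ → ℤ, (∀ᶠ n : ℤ in atTop, q.hilbertFunction n = hilbertSum (d + 2) e n) ∧ e 2 ≤ 0 ∧
      (e 2 = 0 → (∀ n : ℤ, -(d : ℤ) ≤ n → q.hilbertFunction n = hilbertSum (d + 2) e n) ∧
        q.reesMaximalIdeal.HasGrade (d + 1) q.reesSucc) := by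
  induction d with
  | zero =>
    intro R _ _ _ q k x hx hqm hk hgrade
    obtain ⟨S, _, _, _, x', q', hx', hqm', hk', -, hle, ⟨c, hc⟩, hgr, -⟩ :=
      exists_superficial_reduction x hx hqm hk hgrade
    obtain ⟨e', hev', hle'⟩ := exists_hilbertSum_one (q := q') (y := x' 0)
      (by rw [hx', Set.range_unique]; rfl) fun n =>
        length_quotient_ne_top (k := k * n) (by rw [pow_mul]; exact pow_right_mono hk' n)
    obtain ⟨e, he, hev⟩ := exists_hilbertSum_extension hc hev'
    have hdiff : ∀ n : ℕ, hilbertSum 2 e (n + 1) - hilbertSum 2 e n = hilbertSum 1 e' (n + 1) :=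
      fun n => by rw [hilbertSum_add_one_sub, hilbertSum_congr he]
    have hmono : Monotone fun n : ℕ => hilbertSum 2 e n - q.hilbertFunction n := by
      refine monotone_nat_of_le_succ fun n => ?_
      have h1 := hdiff n
      have h2 := hle' (n + 1)
      have h3 := hle n
      push_cast at h2 ⊢
      linarith
    have hnonpos : ∀ n : ℕ, hilbertSum 2 e n - q.hilbertFunction n ≤ 0 := by
      intro n
      obtain ⟨M, hM⟩ := eventually_atTop.mp hev
      have h1 := hmono (le_max_left n M.toNat)
      have h2 := hM (max n M.toNat : ℕ) (by omega)
      simp only at h1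
      linarith
    -- H(0) = 0, and only the constant term e_2 of P survives at 0.
    have hzero : hilbertSum 2 e (0 : ℕ) - q.hilbertFunction (0 : ℕ) = e 2 := by
      have h1 := hilbertSum_neg (d := 2) (k := 0) (e := e) (by omega) (by omega)
      rw [hilbertFunction_of_nonpos q (by simp)]
      simpa using h1
    refine ⟨e, hev, hzero ▸ hnonpos 0, fun he2 => ?_⟩
    have heq : ∀ n : ℕ, q.hilbertFunction n = hilbertSum 2 e n := by
      intro n
      have h1 := hmono (Nat.zero_le n)
      have h2 := hnonpos n
      simp only at h1
      linarith
    refine ⟨fun n hn => ?_, hgr (fun n => ?_) 0 trivial⟩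
    · lift n to ℕ using by simpa using hn
      exact heq n
    -- H_q'(n+1) is squeezed between H_q(n+1) - H_q(n) and P_q'(n+1), which now coincide.
    · have h1 := heq n
      have h2 := heq (n + 1)
      have h3 := hdiff n
      have h4 := hle' (n + 1)
      have h5 := hle n
      push_cast at h2 h4
      linarith
  | succ d ih =>
    intro R _ _ _ q k x hx hqm hk hgrade
    obtain ⟨S, _, _, _, x', q', hx', hqm', hk', hgrade', -, ⟨c, hc⟩, hgr, hgr1⟩ :=
      exists_superficial_reduction x hx hqm hk hgrade
    obtain ⟨e', hev', he2', hzero'⟩ := ih x' hx' hqm' hk' hgrade'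
    obtain ⟨e, he, hev⟩ := exists_hilbertSum_extension hc hev'
    have he2 := he 2 (by omega)
    refine ⟨e, hev, by rwa [he2], fun h2 => ?_⟩
    obtain ⟨heq', hgrq'⟩ := hzero' (by rwa [← he2])
    have hdiff := hgr1 (hgrq'.mono (by omega))
    refine ⟨?_, hgr hdiff _ hgrq'⟩
    -- The inductive agreement is used at n + 1 ≥ -d, which gains one negative integer; for n < 0
    -- all the Hilbert functions involved are 0.
    have hstep : ∀ n : ℤ, -((d + 1 : ℕ) : ℤ) ≤ n →
        q.hilbertFunction n - hilbertSum (d + 3) e n =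
          q.hilbertFunction (n + 1) - hilbertSum (d + 3) e (n + 1) := by
      intro n hn
      have h1 := hilbertSum_add_one_sub (d + 2) e n
      rw [hilbertSum_congr he, ← heq' _ (by push_cast at hn; linarith)] at h1
      rcases lt_or_ge n 0 with hneg | hpos
      · rw [hilbertFunction_of_nonpos q' (by omega)] at h1
        rw [hilbertFunction_of_nonpos q (by omega), hilbertFunction_of_nonpos q (by omega)]
        linarith
      · have h2 := hdiff n.toNat
        rw [Int.toNat_of_nonneg hpos] at h2
        linarith
    have hconst : ∀ n : ℤ, -((d + 1 : ℕ) : ℤ) ≤ n → ∀ m : ℕ,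
        q.hilbertFunction n - hilbertSum (d + 3) e n =
          q.hilbertFunction (n + m) - hilbertSum (d + 3) e (n + m) := by
      intro n hn m
      induction m with
      | zero => simp
      | succ m ihm =>
        rw [ihm, hstep _ (by omega)]
        push_cast
        rw [add_assoc]
    intro n hn
    obtain ⟨M, hM⟩ := eventually_atTop.mp hev
    have h1 := hconst n hn (M - n).toNat
    have h2 := hM (n + (M - n).toNat) (by omega)
    linarith

end Ideal

/-! ### The main theorem. -/

theorem theorem3p5 {R : Type*} [CommRing R] [IsLocalRing R] [IsNoetherianRing R]
    (d : ℕ) (hd : 2 ≤ d) (hdim : ringKrullDim R = d)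
    (hdepth : ((d - 1 : ℕ) : ℕ∞) ≤ IsLocalRing.ringDepth R)
    (q : Ideal R) (hq : q.IsParameterIdeal) :
    q.IsHilbertCoeff d (q.hilbertCoeff d) ∧
    IsLeast (q.postulationSet d) (q.postulationNumber d) ∧
    q.hilbertCoeff d 2 ≤ 0 ∧
    (q.hilbertCoeff d 2 = 0 ↔
      q.postulationNumber d < 2 - (d : ℤ) ∧ ((d - 1 : ℕ) : ℕ∞) ≤ q.assocGradedDepth) ∧
    (q.hilbertCoeff d 2 = 0 → ∀ i, 3 ≤ i → i ≤ d → q.hilbertCoeff d i = 0) := by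
  obtain ⟨d', x, hd', hx, hrad⟩ := hq
  obtain rfl : d' = d := by
    rw [hd'] at hdim
    exact_mod_cast hdim
  obtain ⟨d, rfl⟩ : ∃ m, d' = m + 2 := ⟨d' - 2, by omega⟩
  have hqm : q ≤ IsLocalRing.maximalIdeal R := hrad ▸ Ideal.le_radical
  obtain ⟨k, hk⟩ := q.exists_radical_pow_le_of_fg (IsNoetherian.noetherian _)
  rw [hrad] at hk
  obtain ⟨e, hev, he2, hzero⟩ := Ideal.exists_hilbertSum_of_hasGrade d x hx hqm hk
    (Ideal.hasGrade_bot_of_le_regularGrade hdepth)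
  have hcoeff : q.IsHilbertCoeff (d + 2) (q.hilbertCoeff (d + 2)) := by
    refine Classical.epsilon_spec (p := q.IsHilbertCoeff (d + 2))
      ⟨fun i => if i ≤ d + 2 then e i else 0, ?_, fun i hi => if_neg (by omega)⟩
    filter_upwards [hev] with n hn
    rw [hn]
    exact hilbertSum_congr (fun i hi => (if_pos hi).symm) n
  have hE : ∀ i ≤ d + 2, q.hilbertCoeff (d + 2) i = e i := by
    refine hilbertSum_unique _ _ _ ?_
    filter_upwards [hcoeff.eventually_eq, hev] with n h1 h2
    rw [← h1, h2]
  have hP : ∀ n, q.hilbertSamuelPoly (d + 2) n = hilbertSum (d + 2) e n := hilbertSum_congr hE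
  have hvanish : ∀ j ∈ q.postulationSet (d + 2), ∀ K : ℕ, K ≤ d + 2 → j < -(K : ℤ) →
      ∀ i ≤ K, e (d + 2 - i) = 0 := by
    intro j hj K hK hjK
    refine eq_zero_of_hilbertSum_neg hK fun i hi => ?_
    rw [← hP, ← hj _ (by omega), Ideal.hilbertFunction_of_nonpos _ (by omega)]
  have hleast : IsLeast (q.postulationSet (d + 2)) (q.postulationNumber (d + 2)) := by
    have hne : (q.postulationSet (d + 2)).Nonempty := by
      obtain ⟨M, hM⟩ := eventually_atTop.mp hev
      exact ⟨M, fun n hn => by rw [hP, hM n hn.le]⟩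
    -- A bound below -dim R would make every coefficient vanish, hence P = 0, although H(1) is the
    -- positive length of R/q.
    have hbdd : BddBelow (q.postulationSet (d + 2)) := by
      refine ⟨-((d + 2 : ℕ) : ℤ), fun j hj => ?_⟩
      by_contra! hlt
      have he : ∀ i ≤ d + 2, e i = 0 := fun i hi => by
        have := hvanish j hj (d + 2) le_rfl hlt (d + 2 - i) (by omega)
        rwa [show d + 2 - (d + 2 - i) = i by omega] at this
      have h1 := hj 1 (by omega)
      rw [hP, hilbertSum_congr (e' := fun _ => 0) he] at h1
      have h2 : Module.length R (R ⧸ q ^ 1) ≠ ⊤ :=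
        Ideal.length_quotient_ne_top (k := k) (by rwa [pow_one])
      have h3 : Nontrivial (R ⧸ q ^ 1) := Ideal.Quotient.nontrivial_iff.mpr fun h =>
        (IsLocalRing.maximalIdeal.isMaximal R).ne_top (top_le_iff.mp (by rwa [← h, pow_one]))
      have h4 : (Module.length R (R ⧸ q ^ 1)).toNat ≠ 0 := by
        rw [Ne, ENat.toNat_eq_zero, not_or]
        exact ⟨Module.length_pos.ne', h2⟩
      have h5 := q.hilbertFunction_natCast 1
      rw [Nat.cast_one, h1] at h5
      refine h4 ?_
      have : hilbertSum (d + 2) (fun _ => 0) 1 = 0 := by simp [hilbertSum]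
      rw [this] at h5
      exact_mod_cast h5.symm
    exact ⟨Int.csInf_mem hne hbdd, fun j hj => csInf_le hbdd hj⟩
  rw [hE 2 (by omega)]
  have hpost : e 2 = 0 → q.postulationNumber (d + 2) < -(d : ℤ) := fun h0 => by
    have : -(d : ℤ) - 1 ∈ q.postulationSet (d + 2) := fun n hn => by
      rw [hP]
      exact (hzero h0).1 n (by omega)
    have := hleast.2 this
    omega
  refine ⟨hcoeff, hleast, he2, ⟨fun h0 => ⟨?_, ?_⟩, fun h => ?_⟩, fun h0 i hi3 hid => ?_⟩
  · have := hpost h0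
    push_cast
    omega
  · exact Ideal.le_assocGradedDepth hqm (hzero h0).2
  -- With dimension d + 2, the bound n(q) < -d gives zeros of P at 0, …, -d, and the last of these
  -- isolates e_2.
  · have := hvanish _ hleast.1 d (by omega) (by have := h.1; push_cast at this; omega) d le_rfl
    rwa [show d + 2 - d = 2 by omega] at this
  · have := hvanish _ hleast.1 d (by omega) (hpost h0) (d + 2 - i) (by omega)
    rwa [show d + 2 - (d + 2 - i) = i by omega, ← hE i hid] at this
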